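/- Let $\tau\in\mathbb C$ with $\operatorname{Im}\tau>0$, and put $q=e^{2\pi i\tau}$ and $q^{s}=e^{2\pi i\tau s}$ for real $s$. Let $$\theta_1(z|\tau)=2\sum_{n=0}^\infty(-1)^n q^{(2n+1)^2/8}\sin\big((2n+1)z\big),\qquad \eta(\tau)=q^{1/24}\prod_{n=1}^\infty(1-q^n),$$ and let $\left(\frac n5\right)$ be the Legendre symbol modulo $5$. (1) For every $z\in\mathbb C$ with $|\operatorname{Im}z|<\pi\operatorname{Im}\tau$ and $\sin 5z\neq0$, the series below converges absolutely, $\theta_1(5z|5\tau)\ne0$, and $$\frac{\sin z\,\sin 2z}{\sin 5z}-\sum_{n=1}^\infty\left(\frac n5\right)\frac{q^n}{1-q^n}\sin 2nz=\frac{\eta^2(5\tau)\,\theta_1(z|\tau)\,\theta_1(2z|\tau)}{2\,\eta(\tau)\,\theta_1(5z|5\tau)}.$$ (2) For every $z\in\mathbb C$ with $|\operatorname{Im}z|<\pi\operatorname{Im}\tau$ and $\sin z\neq0$, the series below converges absolutely, $\theta_1(z|\tau)\neq0$, and $$\sum_{n=1}^\infty\frac{q^n-q^{2n}-q^{3n}+q^{4n}}{1-q^{5n}}\sin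 2nz=\frac{\eta^2(\tau)\,\theta_1(z|5\tau)\,\theta_1(2z|5\tau)}{2\,\eta(5\tau)\,\theta_1(z|\tau)}.$$ (3) These identities parameterize Ramanujan's identities $$1-5\sum_{n=1}^\infty\left(\frac n5\right)\frac{nq^n}{1-q^n}=\frac{\eta^5(\tau)}{\eta(5\tau)},\qquad \sum_{n=1}^\infty\left(\frac n5\right)\frac{q^n}{(1-q^n)^2}=\frac{\eta^5(5\tau)}{\eta(\tau)},$$ in which both series converge absolutely, in the following sense. After division by $z$, as $z\to0$ ($z\ne0$), the left and right sides of (1) tend to $\frac25$ times the left and right sides, respectively, of the first of these identities, and the left and right sides of (2) tend to $2$ times the left and right sides, respectively, of the second; and both of Ramanujan's identities hold. -/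

import Mathlib

open Complex Filter Topology

namespace ThetaLambert

instance factPrimeFive : Fact (Nat.Prime 5) := ⟨Nat.prime_five⟩

/-- `q = exp (2 π i τ)`. -/
noncomputable def q (τ : ℂ) : ℂ := cexp (2 * Real.pi * I * τ)

/-- The Jacobi theta function
`θ₁(z | τ) = 2 ∑_{n ≥ 0} (-1)^n q^((2n+1)²/8) sin ((2n+1) z)`,
where `q^s` stands for `exp (2 π i τ s)`. -/
noncomputable def theta1 (z τ : ℂ) : ℂ :=
  2 * ∑' n : ℕ, (-1 : ℂ) ^ n * cexp (2 * Real.pi * I * τ * ((2 * (n : ℂ) + 1) ^ 2 / 8))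
    * sin ((2 * (n : ℂ) + 1) * z)

/-- The Legendre symbol `(n / 5)` as a complex number. -/
noncomputable def chi5 (n : ℕ+) : ℂ := (legendreSym 5 ((n : ℕ) : ℤ) : ℂ)

/-- The term `(n/5) q^n / (1 - q^n) sin (2nz)`. -/
noncomputable def termA (τ z : ℂ) (n : ℕ+) : ℂ :=
  chi5 n * (q τ ^ (n : ℕ) / (1 - q τ ^ (n : ℕ))) * sin (2 * ((n : ℕ) : ℂ) * z)

/-- The term `(q^n - q^(2n) - q^(3n) + q^(4n)) / (1 - q^(5n)) sin (2nz)`. -/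
noncomputable def termB (τ z : ℂ) (n : ℕ+) : ℂ :=
  (q τ ^ (n : ℕ) - q τ ^ (2 * (n : ℕ)) - q τ ^ (3 * (n : ℕ)) + q τ ^ (4 * (n : ℕ)))
    / (1 - q τ ^ (5 * (n : ℕ))) * sin (2 * ((n : ℕ) : ℂ) * z)

/-- `sin z sin 2z / sin 5z - ∑_{n ≥ 1} (n/5) q^n / (1 - q^n) sin (2nz)`. -/
noncomputable def lambertA (τ z : ℂ) : ℂ :=
  sin z * sin (2 * z) / sin (5 * z) - ∑' n : ℕ+, termA τ z n

/-- `∑_{n ≥ 1} (q^n - q^(2n) - q^(3n) + q^(4n)) / (1 - q^(5n)) sin (2nz)`. -/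
noncomputable def lambertB (τ z : ℂ) : ℂ := ∑' n : ℕ+, termB τ z n

/-- `η²(5τ) θ₁(z|τ) θ₁(2z|τ) / (2 η(τ) θ₁(5z|5τ))`. -/
noncomputable def quotientA (τ z : ℂ) : ℂ :=
  ModularForm.eta (5 * τ) ^ 2 * theta1 z τ * theta1 (2 * z) τ
    / (2 * ModularForm.eta τ * theta1 (5 * z) (5 * τ))

/-- `η²(τ) θ₁(z|5τ) θ₁(2z|5τ) / (2 η(5τ) θ₁(z|τ))`. -/
noncomputable def quotientB (τ z : ℂ) : ℂ :=
  ModularForm.eta τ ^ 2 * theta1 z (5 * τ) * theta1 (2 * z) (5 * τ)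
    / (2 * ModularForm.eta (5 * τ) * theta1 z τ)

/-- The term `(n/5) n q^n / (1 - q^n)`. -/
noncomputable def ramanujanTermA (τ : ℂ) (n : ℕ+) : ℂ :=
  chi5 n * (((n : ℕ) : ℂ) * q τ ^ (n : ℕ) / (1 - q τ ^ (n : ℕ)))

/-- The term `(n/5) q^n / (1 - q^n)²`. -/
noncomputable def ramanujanTermB (τ : ℂ) (n : ℕ+) : ℂ :=
  chi5 n * (q τ ^ (n : ℕ) / (1 - q τ ^ (n : ℕ)) ^ 2)

end ThetaLambert

/-! Both Lambert identities are the same four-term relation for L = θ₁'/θ₁, at two choices of v.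
Jacobi's addition formula writes θ₁(x+y)θ₁(x-y) as a determinant E(x)O(y) - O(x)E(y)
(`theta1_addition`). Its logarithmic derivative in x is L(x+y) + L(x-y). Subtract the values at y =
2v from those at y = v: the numerator factors as the Wronskian of E and O at z, which is
-θ₁(2z)θ₁'(0), times the determinant θ₁(3v)θ₁(v). This is `theta1LogDeriv_four_term`.

For v = π/5 and modulus τ, the denominator completes to θ₁(5z|5τ) by multisection over fifth roots
of unity (`theta1_prod_real_shift`), and the relation becomes -4√5 times the first quotient. On the
other side L has the expansion cot z + 4 ∑ qⁿ/(1-qⁿ) sin 2nz; the four shifts twist the coefficients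
by a quadratic Gauss sum, which produces (n/5), and the cotangents add up to the trigonometric term.

For v = πτ and modulus 5τ, the shifts multiply e^{2iz} by powers of q, and the denominator completes
to θ₁(z|τ) by splitting exponents into residues mod 5 (`theta1_prod_imag_shift`). The shifted points
leave the real axis, so L is expanded in the strip above it, where the cotangent is absorbed into
the series.

The product formulas rest on Jacobi's triple product, obtained as a limit of the finite q-binomial
theorem. Ramanujan's identities follow by dividing by z and letting z → 0, using θ₁'(0) = 2η³ and
termwise differentiation; for the second, a double series is also summed in both orders. -/

namespace ThetaLambert

/-! ### Infinite q-products. -/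

/-- The infinite `q`-Pochhammer symbol `(x; q)_∞`. -/
noncomputable def qPoch (q x : ℂ) : ℂ := ∏' n : ℕ, (1 - q ^ n * x)

lemma summable_pow_mul_norm {q : ℂ} (hq : ‖q‖ < 1) (x : ℂ) :
    Summable fun n : ℕ => ‖-(q ^ n * x)‖ := by
  simpa using (summable_geometric_of_lt_one (norm_nonneg _) hq).mul_right ‖x‖

lemma multipliable_qPoch {q : ℂ} (hq : ‖q‖ < 1) (x : ℂ) :
    Multipliable fun n : ℕ => 1 - q ^ n * x := by
  simpa only [sub_eq_add_neg] using multipliable_one_add_of_summable (summable_pow_mul_norm hq x)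

lemma tendsto_qPoch {q : ℂ} (hq : ‖q‖ < 1) (x : ℂ) :
    Tendsto (fun n => ∏ j ∈ Finset.range n, (1 - q ^ j * x)) atTop (𝓝 (qPoch q x)) :=
  (multipliable_qPoch hq x).hasProd.tendsto_prod_nat

lemma qPoch_ne_zero {q : ℂ} (hq : ‖q‖ < 1) {x : ℂ} (h : ∀ n : ℕ, 1 - q ^ n * x ≠ 0) :
    qPoch q x ≠ 0 := by
  simp only [qPoch, sub_eq_add_neg] at *
  exact tprod_one_add_ne_zero_of_summable h (summable_pow_mul_norm hq x)

lemma qPoch_eq_mul {q : ℂ} (hq : ‖q‖ < 1) (x : ℂ) :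
    qPoch q x = (1 - x) * qPoch q (q * x) := by
  have h : ∀ n : ℕ, 1 - q ^ (n + 1) * x = 1 - q ^ n * (q * x) := fun n => by ring
  have h1 := tprod_eq_zero_mul' (f := fun n : ℕ => 1 - q ^ n * x)
    (by simpa only [h] using multipliable_qPoch hq (q * x))
  simpa only [h, pow_zero, one_mul, qPoch] using h1

lemma one_sub_pow_mul_ne_zero {q x : ℂ} (hq : ‖q‖ < 1) (hx : ‖x‖ < 1) (n : ℕ) :
    1 - q ^ n * x ≠ 0 := by
  intro h
  have h1 : ‖q ^ n * x‖ < 1 := by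
    rw [norm_mul, norm_pow]
    exact (mul_le_of_le_one_left (norm_nonneg _) (pow_le_one₀ (norm_nonneg _) hq.le)).trans_lt hx
  rw [← sub_eq_zero.mp h] at h1
  simp at h1

/-! ### Gaussian binomials and the triple product. -/

/-- Gaussian binomial coefficients, defined by the `q`-Pascal rule. -/
noncomputable def gaussBinom (q : ℂ) : ℕ → ℕ → ℂ
  | _, 0 => 1
  | 0, _ + 1 => 0
  | N + 1, k + 1 => q ^ (k + 1) * gaussBinom q N (k + 1) + gaussBinom q N k

lemma gaussBinom_zero (q : ℂ) (N : ℕ) : gaussBinom q N 0 = 1 := by cases N <;> rfl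

lemma gaussBinom_succ (q : ℂ) (N k : ℕ) : gaussBinom q (N + 1) (k + 1) =
    q ^ (k + 1) * gaussBinom q N (k + 1) + gaussBinom q N k := rfl

lemma gaussBinom_eq_zero (q : ℂ) : ∀ N k : ℕ, N < k → gaussBinom q N k = 0
  | 0, k + 1, _ => rfl
  | N + 1, k + 1, h => by
    rw [gaussBinom_succ, gaussBinom_eq_zero q N (k + 1) (by omega),
      gaussBinom_eq_zero q N k (by omega)]
    simp

/-- Finite form of `(q; q)_n`. -/
noncomputable def qFact (q : ℂ) (n : ℕ) : ℂ := ∏ j ∈ Finset.range n, (1 - q ^ (j + 1))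

lemma qFact_succ (q : ℂ) (n : ℕ) : qFact q (n + 1) = qFact q n * (1 - q ^ (n + 1)) :=
  Finset.prod_range_succ _ _

lemma gaussBinom_self (q : ℂ) (N : ℕ) : gaussBinom q N N = 1 := by
  induction N with
  | zero => rfl
  | succ N ih => rw [gaussBinom_succ, gaussBinom_eq_zero q N _ (by omega), ih]; simp

/-- The Pascal rule matches 1 - q^(m+n+2) = q^(m+1)(1 - q^(n+1)) + (1 - q^(m+1)). Being free of
division, the closed form holds for every q. -/
lemma gaussBinom_mul_qFact (q : ℂ) : ∀ m n : ℕ,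
    gaussBinom q (m + n) m * (qFact q m * qFact q n) = qFact q (m + n)
  | 0, n => by simp [gaussBinom_zero, qFact]
  | m + 1, 0 => by simp [gaussBinom_self, qFact]
  | m + 1, n + 1 => by
    have h1 := gaussBinom_mul_qFact q (m + 1) n
    have h2 := gaussBinom_mul_qFact q m (n + 1)
    rw [show m + 1 + (n + 1) = (m + n + 1) + 1 by ring, gaussBinom_succ, qFact_succ q (m + n + 1)]
    rw [show m + 1 + n = m + n + 1 by ring] at h1
    rw [show m + (n + 1) = m + n + 1 by ring] at h2
    rw [qFact_succ q m] at h1 ⊢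
    rw [qFact_succ q n] at h2 ⊢
    have : q ^ (m + n + 1 + 1) = q ^ (m + 1) * q ^ (n + 1) := by ring
    rw [this]
    linear_combination q ^ (m + 1) * (1 - q ^ (n + 1)) * h1 + (1 - q ^ (m + 1)) * h2

/-- The finite `q`-binomial theorem. -/
lemma prod_one_add_eq_sum (p : ℂ) (N : ℕ) (x : ℂ) :
    ∏ j ∈ Finset.range N, (1 + x * p ^ (2 * j + 1)) =
      ∑ k ∈ Finset.range (N + 1), gaussBinom (p ^ 2) N k * p ^ (k ^ 2) * x ^ k := by
  induction N generalizing x with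
  | zero => simp [gaussBinom]
  | succ N ih =>
    rw [Finset.prod_range_succ']
    have h1 : ∀ j, 1 + x * p ^ (2 * (j + 1) + 1) = 1 + (x * p ^ 2) * p ^ (2 * j + 1) := by
      intro j; ring
    simp only [h1, ih, mul_zero, zero_add, pow_one]
    rw [Finset.sum_range_succ' _ (N + 1)]
    simp only [gaussBinom_succ, gaussBinom_zero, add_mul, Finset.sum_add_distrib]
    have h2 : ∑ k ∈ Finset.range (N + 1), gaussBinom (p ^ 2) N k * p ^ k ^ 2 * (x * p ^ 2) ^ k
        = ∑ k ∈ Finset.range (N + 1),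
          (p ^ 2) ^ (k + 1) * gaussBinom (p ^ 2) N (k + 1) * p ^ (k + 1) ^ 2 * x ^ (k + 1) + 1 := by
      rw [Finset.sum_range_succ', Finset.sum_range_succ _ N,
        gaussBinom_eq_zero _ N (N + 1) (by omega), gaussBinom_zero]
      simp only [mul_zero, zero_mul, add_zero]
      congr 1
      · refine Finset.sum_congr rfl fun k _ => ?_
        ring
      · simp
    have h3 : ∀ k, gaussBinom (p ^ 2) N k * p ^ (k + 1) ^ 2 * x ^ (k + 1) =
      gaussBinom (p ^ 2) N k * p ^ k ^ 2 * (x * p ^ 2) ^ k * (x * p) := by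
      intro k; ring
    simp only [h3, ← Finset.sum_mul, h2]
    ring

/-- Each factor with a negative power of p is turned inside out: 1 + y p^(-(2j+1)) = y p^(-(2j+1))
(1 + y⁻¹ p^(2j+1)). -/
lemma prod_one_add_inv {p y : ℂ} (hp : p ≠ 0) (hy : y ≠ 0) (n : ℕ) :
    ∏ j ∈ Finset.range n, (1 + y * (p ^ (2 * n))⁻¹ * p ^ (2 * j + 1)) =
      y ^ n * (p ^ (n ^ 2))⁻¹ * ∏ j ∈ Finset.range n, (1 + y⁻¹ * p ^ (2 * j + 1)) := by
  rw [← Finset.prod_range_reflect]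
  have : ∀ j ∈ Finset.range n, 1 + y * (p ^ (2 * n))⁻¹ * p ^ (2 * (n - 1 - j) + 1) =
      y * (p ^ (2 * j + 1))⁻¹ * (1 + y⁻¹ * p ^ (2 * j + 1)) := by
    intro j hj
    obtain ⟨k, rfl⟩ : ∃ k, n = j + k + 1 := ⟨n - 1 - j, by have := Finset.mem_range.mp hj; omega⟩
    rw [show j + k + 1 - 1 - j = k by omega]
    field_simp
    ring
  rw [Finset.prod_congr rfl this, Finset.prod_mul_distrib]
  congr 1
  -- What is left is 1 + 3 + ⋯ + (2n-1) = n². The factorwise identity depends on n, so the induction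
  -- asks for it again.
  induction n with
  | zero => simp
  | succ n ih =>
    rw [Finset.prod_range_succ, ih]
    · field_simp
      ring
    · intro j hj
      have := Finset.mem_range.mp hj
      obtain ⟨k, rfl⟩ : ∃ k, n = j + k + 1 := ⟨n - 1 - j, by omega⟩
      rw [show j + k + 1 - 1 - j = k by omega]
      field_simp
      ring

/-- The finite form of Jacobi's triple product identity. -/
lemma finite_triple_product {p y : ℂ} (hp : p ≠ 0) (hy : y ≠ 0) (n : ℕ) :
    (∏ j ∈ Finset.range n, (1 + y * p ^ (2 * j + 1))) *
      ∏ j ∈ Finset.range n, (1 + y⁻¹ * p ^ (2 * j + 1)) =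
    ∑ k ∈ Finset.range (2 * n + 1),
      gaussBinom (p ^ 2) (2 * n) k * (p ^ (((k : ℤ) - n) ^ 2) * y ^ ((k : ℤ) - n)) := by
  -- Taking x = y p^(-2n) in 2n factors centres the exponents: they run over the odd numbers from
  -- -(2n-1) to 2n-1.
  have h := prod_one_add_eq_sum p (2 * n) (y * (p ^ (2 * n))⁻¹)
  rw [two_mul, Finset.prod_range_add, ← two_mul, prod_one_add_inv hp hy] at h
  have h1 : ∀ j, 1 + y * (p ^ (2 * n))⁻¹ * p ^ (2 * (n + j) + 1) = 1 + y * p ^ (2 * j + 1) := by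
    intro j
    field_simp
    ring
  simp only [h1] at h
  have h2 : y ^ n * (p ^ (n ^ 2))⁻¹ ≠ 0 := by positivity
  apply mul_left_cancel₀ h2
  rw [Finset.mul_sum]
  calc _ = _ := by ring
    _ = _ := h
    _ = _ := by
      refine Finset.sum_congr rfl fun k _ => ?_
      have e1 : p ^ (((k : ℤ) - n) ^ 2) = p ^ (k ^ 2) * p ^ (n ^ 2) * (p ^ (2 * n * k))⁻¹ := by
        rw [show ((k : ℤ) - n) ^ 2 = ((k ^ 2 + n ^ 2 : ℕ) : ℤ) - (2 * n * k : ℕ) by push_cast; ring,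
          zpow_sub₀ hp, zpow_natCast, zpow_natCast, pow_add, div_eq_mul_inv]
      have e2 : y ^ ((k : ℤ) - n) = y ^ k * (y ^ n)⁻¹ := by
        rw [zpow_sub₀ hy, zpow_natCast, zpow_natCast, div_eq_mul_inv]
      rw [e1, e2, mul_pow, inv_pow, ← pow_mul]
      field_simp

lemma tendsto_qFact {q : ℂ} (hq : ‖q‖ < 1) : Tendsto (qFact q) atTop (𝓝 (qPoch q q)) := by
  have := tendsto_qPoch hq q
  simpa only [← pow_succ] using! this

lemma qFact_ne_zero {q : ℂ} (hq : ‖q‖ < 1) (n : ℕ) : qFact q n ≠ 0 :=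
  Finset.prod_ne_zero_iff.mpr fun j _ => by
    simpa only [pow_succ] using one_sub_pow_mul_ne_zero hq hq j

lemma qPoch_ne_zero_of_norm_lt_one {q x : ℂ} (hq : ‖q‖ < 1) (hx : ‖x‖ < 1) : qPoch q x ≠ 0 :=
  qPoch_ne_zero hq (one_sub_pow_mul_ne_zero hq hx)

lemma gaussBinom_eq_div {q : ℂ} (hq : ‖q‖ < 1) (m n : ℕ) :
    gaussBinom q (m + n) m = qFact q (m + n) / (qFact q m * qFact q n) :=
  eq_div_of_mul_eq (mul_ne_zero (qFact_ne_zero hq m) (qFact_ne_zero hq n))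
    (gaussBinom_mul_qFact q m n)

/-- `qFact q n` converges to a nonzero limit, so it and its inverse are bounded. The uniform bound
supplies the majorant for dominated convergence in the triple product. -/
lemma exists_norm_gaussBinom_le {q : ℂ} (hq : ‖q‖ < 1) :
    ∃ C : ℝ, ∀ N k : ℕ, ‖gaussBinom q N k‖ ≤ C := by
  have h1 := (tendsto_qFact hq).norm.bddAbove_range
  have h2 := ((tendsto_qFact hq).inv₀ (qPoch_ne_zero_of_norm_lt_one hq hq)).norm.bddAbove_range
  obtain ⟨A, hA⟩ := h1
  obtain ⟨B, hB⟩ := h2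
  have hA : ∀ n, ‖qFact q n‖ ≤ A := fun n => hA ⟨n, rfl⟩
  have hB : ∀ n, ‖(qFact q n)⁻¹‖ ≤ B := fun n => hB ⟨n, rfl⟩
  have hA0 := (norm_nonneg _).trans (hA 0)
  have hB0 := (norm_nonneg _).trans (hB 0)
  refine ⟨A * (B * B), fun N k => ?_⟩
  rcases lt_or_ge N k with h | h
  · rw [gaussBinom_eq_zero q N k h, norm_zero]
    positivity
  · obtain ⟨n, rfl⟩ := Nat.exists_eq_add_of_le h
    rw [gaussBinom_eq_div hq, div_eq_mul_inv, mul_inv, norm_mul, norm_mul]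
    exact mul_le_mul (hA _) (mul_le_mul (hB _) (hB _) (norm_nonneg _) hB0) (by positivity) hA0

lemma tendsto_gaussBinom_central {q : ℂ} (hq : ‖q‖ < 1) (m : ℤ) :
    Tendsto (fun n : ℕ => gaussBinom q (2 * n) (n + m).toNat) atTop (𝓝 (qPoch q q)⁻¹) := by
  have hE := qPoch_ne_zero_of_norm_lt_one hq hq
  have ht : ∀ m : ℤ, Tendsto (fun n : ℕ => ((n : ℤ) + m).toNat) atTop atTop := fun m =>
    tendsto_atTop_mono (fun n => by omega) (tendsto_sub_atTop_nat m.natAbs)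
  have h2 : Tendsto (fun n : ℕ => 2 * n) atTop atTop :=
    tendsto_atTop_mono (f := fun n : ℕ => n) (fun n => by omega) tendsto_id
  have h := ((tendsto_qFact hq).comp h2).div
    (((tendsto_qFact hq).comp (ht m)).mul ((tendsto_qFact hq).comp (ht (-m)))) (mul_ne_zero hE hE)
  rw [show qPoch q q / (qPoch q q * qPoch q q) = (qPoch q q)⁻¹ by field_simp] at h
  refine h.congr' ?_
  filter_upwards [eventually_ge_atTop m.natAbs] with n hn
  have e : 2 * n = ((n : ℤ) + m).toNat + ((n : ℤ) + -m).toNat := by omega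
  simp only [Function.comp, Pi.div_apply]
  rw [e, gaussBinom_eq_div hq]

/-- Jacobi's triple product identity. -/
theorem tsum_eq_triple_product {p y : ℂ} (hp0 : p ≠ 0) (hp : ‖p‖ < 1) (hy : y ≠ 0)
    (hs : Summable fun m : ℤ => p ^ (m ^ 2) * y ^ m) :
    ∑' m : ℤ, p ^ (m ^ 2) * y ^ m =
      qPoch (p ^ 2) (-(p * y)) * qPoch (p ^ 2) (-(p * y⁻¹)) * qPoch (p ^ 2) (p ^ 2) := by
  have hq : ‖p ^ 2‖ < 1 := by
    rw [norm_pow]; exact pow_lt_one₀ (norm_nonneg _) hp two_ne_zero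
  have hE := qPoch_ne_zero_of_norm_lt_one hq hq
  obtain ⟨C, hC⟩ := exists_norm_gaussBinom_le hq
  -- This is the finite identity reindexed by m = k - n. The test is needed for m < -n, where
  -- `toNat` would give 0 and the coefficient 1; for m > n the binomial already vanishes.
  let f : ℕ → ℤ → ℂ := fun n m =>
    if 0 ≤ (n : ℤ) + m then gaussBinom (p ^ 2) (2 * n) (n + m).toNat * (p ^ (m ^ 2) * y ^ m) else 0
  have hlim : Tendsto (fun n => ∑' m, f n m) atTop
      (𝓝 (∑' m : ℤ, (qPoch (p ^ 2) (p ^ 2))⁻¹ * (p ^ (m ^ 2) * y ^ m))) := by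
    refine tendsto_tsum_of_dominated_convergence (hs.norm.mul_left C) (fun m => ?_)
      (Eventually.of_forall fun n m => ?_)
    · refine ((tendsto_gaussBinom_central hq m).mul_const _).congr' ?_
      filter_upwards [eventually_ge_atTop m.natAbs] with n hn
      simp only [f]
      rw [if_pos (by omega)]
    · simp only [f]
      split_ifs
      · rw [norm_mul]
        exact mul_le_mul_of_nonneg_right (hC _ _) (norm_nonneg _)
      · rw [norm_zero]
        exact mul_nonneg ((norm_nonneg _).trans (hC 0 0)) (norm_nonneg _)
  have hfin : ∀ n, ∑' m, f n m = (∏ j ∈ Finset.range n, (1 - (p ^ 2) ^ j * -(p * y))) *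
      ∏ j ∈ Finset.range n, (1 - (p ^ 2) ^ j * -(p * y⁻¹)) := by
    intro n
    have h1 := finite_triple_product hp0 hy n
    have h2 : ∀ (x : ℂ) (j : ℕ), 1 - (p ^ 2) ^ j * -(p * x) = 1 + x * p ^ (2 * j + 1) := by
      intro x j; ring
    simp only [h2, h1]
    obtain ⟨e, he⟩ : ∃ e : ℕ ↪ ℤ, ∀ k, e k = (k : ℤ) - n :=
      ⟨⟨fun k => (k : ℤ) - n, fun a b h => by dsimp only at h; omega⟩, fun _ => rfl⟩
    rw [tsum_eq_sum (s := (Finset.range (2 * n + 1)).map e), Finset.sum_map]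
    · refine Finset.sum_congr rfl fun k _ => ?_
      simp only [f, he]
      rw [if_pos (by omega), show ((n : ℤ) + (k - n)).toNat = k by omega]
    · intro m hm
      simp only [f]
      split_ifs with h
      · rw [gaussBinom_eq_zero, zero_mul]
        by_contra hlt
        apply hm
        simp only [Finset.mem_map, Finset.mem_range, he]
        exact ⟨((n : ℤ) + m).toNat, by omega, by omega⟩
      · rfl
  have hlim2 := (tendsto_qPoch hq (-(p * y))).mul (tendsto_qPoch hq (-(p * y⁻¹)))
  simp only [← hfin] at hlim2
  have h := tendsto_nhds_unique hlim2 hlim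
  rw [tsum_mul_left] at h
  rw [h]
  field_simp

/-! ### Product expansion of θ₁. -/

/-- The product expansion of the two-variable Jacobi theta function. -/
theorem jacobiTheta₂_eq_prod {τ : ℂ} (hτ : 0 < τ.im) (z : ℂ) :
    jacobiTheta₂ z τ = qPoch (q τ) (-(cexp (Real.pi * I * τ) * cexp (2 * Real.pi * I * z))) *
      qPoch (q τ) (-(cexp (Real.pi * I * τ) * cexp (-(2 * Real.pi * I * z)))) *
        qPoch (q τ) (q τ) := by
  have hp : ‖cexp (Real.pi * I * τ)‖ < 1 := by
    rw [norm_exp]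
    simp
    positivity
  have hterm : ∀ m : ℤ, jacobiTheta₂_term m z τ =
      cexp (Real.pi * I * τ) ^ (m ^ 2) * cexp (2 * Real.pi * I * z) ^ m := by
    intro m
    rw [jacobiTheta₂_term, ← exp_int_mul, ← exp_int_mul, ← exp_add]
    congr 1
    push_cast
    ring
  have hq : cexp (Real.pi * I * τ) ^ 2 = q τ := by
    rw [q, ← exp_nat_mul]
    congr 1
    push_cast
    ring
  have h := tsum_eq_triple_product (exp_ne_zero _) hp (exp_ne_zero (2 * Real.pi * I * z))
    (by simpa only [hterm] using (summable_jacobiTheta₂_term_iff z τ).mpr hτ)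
  rw [jacobiTheta₂, tsum_congr hterm, h, hq, exp_neg]

lemma norm_q_lt_one {τ : ℂ} (hτ : 0 < τ.im) : ‖q τ‖ < 1 := by
  rw [q, norm_exp]
  simp
  positivity

lemma q_ne_zero (τ : ℂ) : q τ ≠ 0 := exp_ne_zero _

/-- `θ₁` in terms of Mathlib's theta function. -/
lemma theta1_eq_jacobiTheta₂ {τ : ℂ} (hτ : 0 < τ.im) (z : ℂ) :
    theta1 z τ = -I * cexp (2 * Real.pi * I * τ / 8) * cexp (I * z) *
      jacobiTheta₂ (z / Real.pi + 1 / 2 + τ / 2) τ := by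
  have hpi : (Real.pi : ℂ) ≠ 0 := by exact_mod_cast Real.pi_ne_zero
  have hs := (summable_jacobiTheta₂_term_iff (z / Real.pi + 1 / 2 + τ / 2) τ).mpr hτ
  -- Pairing the indices n and -n-1 turns exponentials into sines.
  have hz := (hs.hasSum.nat_add_neg_add_one).tsum_eq
  rw [jacobiTheta₂, ← hz, theta1, ← tsum_mul_left, ← tsum_mul_left]
  refine tsum_congr fun n => ?_
  have hneg : cexp (Real.pi * I * n) = (-1) ^ n := by
    rw [mul_comm, exp_nat_mul, exp_pi_mul_I]
  rw [sin, jacobiTheta₂_term, jacobiTheta₂_term]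
  have e1 : cexp (2 * Real.pi * I * (n : ℤ) * (z / Real.pi + 1 / 2 + τ / 2) +
      Real.pi * I * (n : ℤ) ^ 2 * τ) = (-1) ^ n * (cexp (2 * Real.pi * I * τ / 8))⁻¹ *
      (cexp (I * z))⁻¹ * (cexp (2 * Real.pi * I * τ * ((2 * (n : ℂ) + 1) ^ 2 / 8)) *
        cexp ((2 * (n : ℂ) + 1) * z * I)) := by
    rw [← hneg, ← exp_neg, ← exp_neg, ← exp_add, ← exp_add, ← exp_add, ← exp_add]
    congr 1
    push_cast
    field_simp
    ring
  have e2 : cexp (2 * Real.pi * I * (-((n : ℤ) + 1) : ℤ) * (z / Real.pi + 1 / 2 + τ / 2) +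
      Real.pi * I * (-((n : ℤ) + 1) : ℤ) ^ 2 * τ) =
      -((-1) ^ n * (cexp (2 * Real.pi * I * τ / 8))⁻¹ *
      (cexp (I * z))⁻¹ * (cexp (2 * Real.pi * I * τ * ((2 * (n : ℂ) + 1) ^ 2 / 8)) *
        cexp (-((2 * (n : ℂ) + 1) * z) * I))) := by
    have h1 : (-1 : ℂ) ^ n = ((-1) ^ n)⁻¹ := by
      rw [← inv_pow]; norm_num
    rw [h1, ← hneg, neg_eq_neg_one_mul (_ * _), ← exp_pi_mul_I, ← exp_neg, ← exp_neg, ← exp_neg,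
      ← exp_add, ← exp_add, ← exp_add, ← exp_add, ← exp_add, exp_eq_exp_iff_exists_int]
    refine ⟨-1, ?_⟩
    push_cast
    field_simp
    ring
  rw [e1, e2]
  have := exp_ne_zero (2 * Real.pi * I * τ / 8)
  have := exp_ne_zero (I * z)
  field_simp
  ring

lemma one_sub_exp_inv (z : ℂ) : 1 - cexp (-(2 * I * z)) = cexp (-(I * z)) * (2 * I * sin z) := by
  rw [sin, show -(2 * I * z) = -(I * z) + -(I * z) by ring, exp_add,
    show -z * I = -(I * z) by ring, show z * I = I * z by ring, exp_neg]
  have := exp_ne_zero (I * z)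
  field_simp
  linear_combination (cexp (I * z) ^ 2 - 1) * I_sq

/-- The product expansion of `θ₁`. -/
theorem theta1_eq_prod {τ : ℂ} (hτ : 0 < τ.im) (z : ℂ) :
    theta1 z τ = 2 * cexp (2 * Real.pi * I * τ / 8) * sin z *
      qPoch (q τ) (q τ * cexp (2 * I * z)) * qPoch (q τ) (q τ * cexp (-(2 * I * z))) *
        qPoch (q τ) (q τ) := by
  have hpi : (Real.pi : ℂ) ≠ 0 := by exact_mod_cast Real.pi_ne_zero
  rw [theta1_eq_jacobiTheta₂ hτ, jacobiTheta₂_eq_prod hτ]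
  have e1 : -(cexp (Real.pi * I * τ) * cexp (2 * Real.pi * I * (z / Real.pi + 1 / 2 + τ / 2))) =
      q τ * cexp (2 * I * z) := by
    rw [q, neg_eq_neg_one_mul, ← exp_pi_mul_I, ← exp_add, ← exp_add, ← exp_add,
      exp_eq_exp_iff_exists_int]
    refine ⟨1, ?_⟩
    push_cast
    field_simp
    ring
  have e2 : -(cexp (Real.pi * I * τ) * cexp (-(2 * Real.pi * I * (z / Real.pi + 1 / 2 + τ / 2)))) =
      cexp (-(2 * I * z)) := by
    rw [neg_eq_neg_one_mul, ← exp_pi_mul_I, ← exp_add, ← exp_add]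
    congr 1
    field_simp
    ring
  rw [e1, e2, qPoch_eq_mul (norm_q_lt_one hτ) (cexp (-(2 * I * z))), one_sub_exp_inv, exp_neg (I * z)]
  have := exp_ne_zero (I * z)
  generalize qPoch (q τ) (q τ * cexp (2 * I * z)) = A
  generalize qPoch (q τ) (q τ * cexp (-(2 * I * z))) = B
  generalize qPoch (q τ) (q τ) = C
  field_simp
  linear_combination -(A * sin z * B * C) * I_sq

/-! ### Addition formula and the four-term relation. -/

lemma hasSum_of_eq {ι : Type*} {f g : ι → ℂ} {a : ℂ} (hg : HasSum g a) (h : ∀ i, f i = g i) :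
    HasSum f a := by rwa [funext h]

/-- `∑ q^(n²) e^(4 i n x)`, the even half of the series in the addition formula of `θ₁`. -/
noncomputable def thetaEven (τ x : ℂ) : ℂ := jacobiTheta₂ (2 * x / Real.pi) (2 * τ)

/-- `∑ q^((n+1/2)²) e^(2 i (2n+1) x)`, the odd half of the series in the addition formula. -/
noncomputable def thetaOdd (τ x : ℂ) : ℂ :=
  cexp (Real.pi * I * τ / 2 + 2 * I * x) * jacobiTheta₂ (2 * x / Real.pi + τ) (2 * τ)

lemma two_mul_im_pos {τ : ℂ} (hτ : 0 < τ.im) : 0 < (2 * τ).im := by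
  simpa using hτ

lemma hasSum_thetaEven {τ : ℂ} (hτ : 0 < τ.im) (x : ℂ) :
    HasSum (fun t : ℤ => cexp (Real.pi * I * τ * (2 * t) ^ 2 / 2 + 2 * I * (2 * t) * x))
      (thetaEven τ x) := by
  have hpi : (Real.pi : ℂ) ≠ 0 := by exact_mod_cast Real.pi_ne_zero
  refine hasSum_of_eq
    (hasSum_jacobiTheta₂_term (2 * x / Real.pi) (two_mul_im_pos hτ)) fun t => ?_
  rw [jacobiTheta₂_term]
  congr 1
  field_simp
  ring

lemma hasSum_thetaOdd {τ : ℂ} (hτ : 0 < τ.im) (x : ℂ) :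
    HasSum (fun t : ℤ => cexp (Real.pi * I * τ * (2 * t + 1) ^ 2 / 2 + 2 * I * (2 * t + 1) * x))
      (thetaOdd τ x) := by
  have hpi : (Real.pi : ℂ) ≠ 0 := by exact_mod_cast Real.pi_ne_zero
  refine hasSum_of_eq ((hasSum_jacobiTheta₂_term (2 * x / Real.pi + τ)
    (two_mul_im_pos hτ)).mul_left (cexp (Real.pi * I * τ / 2 + 2 * I * x))) fun t => ?_
  rw [jacobiTheta₂_term, ← exp_add]
  congr 1
  field_simp
  ring

lemma hasSum_theta1 {τ : ℂ} (hτ : 0 < τ.im) (x : ℂ) :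
    HasSum (fun n : ℤ => -I * cexp (Real.pi * I * τ * (2 * n + 1) ^ 2 / 4 + Real.pi * I * n +
      I * (2 * n + 1) * x)) (theta1 x τ) := by
  have hpi : (Real.pi : ℂ) ≠ 0 := by exact_mod_cast Real.pi_ne_zero
  rw [theta1_eq_jacobiTheta₂ hτ]
  refine hasSum_of_eq
    ((hasSum_jacobiTheta₂_term (x / Real.pi + 1 / 2 + τ / 2) hτ).mul_left
      (-I * cexp (2 * Real.pi * I * τ / 8) * cexp (I * x))) fun n => ?_
  rw [jacobiTheta₂_term, mul_assoc (-I), mul_assoc (-I), ← exp_add, ← exp_add]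
  congr 2
  field_simp
  ring

/-- Splitting `ℤ × ℤ` by the parity of the difference of coordinates. -/
noncomputable def paritySplit : (ℤ × ℤ) ⊕ (ℤ × ℤ) ≃ ℤ × ℤ :=
  Equiv.ofBijective
    (Sum.elim (fun a => (a.1 + a.2, a.1 - a.2)) (fun a => (a.1 + a.2, a.1 - a.2 - 1))) <| by
    constructor
    · rintro (⟨a, b⟩ | ⟨a, b⟩) (⟨c, d⟩ | ⟨c, d⟩) h <;>
        simp only [Sum.elim_inl, Sum.elim_inr, Prod.mk.injEq] at h
      · rw [show a = c by omega, show b = d by omega]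
      · omega
      · omega
      · rw [show a = c by omega, show b = d by omega]
    · rintro ⟨m, n⟩
      rcases Int.even_or_odd' (m - n) with ⟨t, h | h⟩
      · exact ⟨Sum.inl (n + t, t), by
          simp only [Sum.elim_inl, Prod.mk.injEq]; omega⟩
      · exact ⟨Sum.inr (n + t + 1, t), by
          simp only [Sum.elim_inr, Prod.mk.injEq]; omega⟩

lemma hasSum_parity_split {F G H : ℤ × ℤ → ℂ} {a b c : ℂ} (hF : HasSum F a) (hG : HasSum G b)
    (hH : HasSum H c) (h1 : ∀ s t, F (s + t, s - t) = G (s, t))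
    (h2 : ∀ s t, F (s + t, s - t - 1) = H (s, t)) : a = b + c :=
  (paritySplit.hasSum_iff.mpr hF).unique
    (HasSum.sum (hasSum_of_eq hG fun p => h1 p.1 p.2) (hasSum_of_eq hH fun p => h2 p.1 p.2))

lemma hasSum_mul_prod {f g : ℤ → ℂ} {a b : ℂ} (hf : HasSum f a) (hg : HasSum g b) :
    HasSum (fun p : ℤ × ℤ => f p.1 * g p.2) (a * b) :=
  hf.mul hg (summable_mul_of_summable_norm hf.summable.norm hg.summable.norm)

/-- Jacobi's addition formula for `θ₁`. -/
theorem theta1_addition {τ : ℂ} (hτ : 0 < τ.im) (x y : ℂ) :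
    theta1 (x + y) τ * theta1 (x - y) τ =
      thetaEven τ x * thetaOdd τ y - thetaOdd τ x * thetaEven τ y := by
  rw [sub_eq_neg_add (thetaEven τ x * thetaOdd τ y)]
  refine hasSum_parity_split (hasSum_mul_prod (hasSum_theta1 hτ (x + y)) (hasSum_theta1 hτ (x - y)))
    (hasSum_mul_prod (hasSum_thetaOdd hτ x) (hasSum_thetaEven hτ y)).neg
    (hasSum_mul_prod (hasSum_thetaEven hτ x) (hasSum_thetaOdd hτ y)) (fun s t => ?_) (fun s t => ?_)
  -- With m = s+t, n = s-t, the parallelogram law gives (2m+1)² + (2n+1)² = 2(2s+1)² + 2(2t)², and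
  -- the linear terms become 2(2s+1)x + 2(2t)y. In the other parity class the odd and even roles are
  -- exchanged.
  · dsimp only
    rw [← exp_add, mul_mul_mul_comm, ← exp_add, neg_mul_neg, I_mul_I, neg_one_mul, neg_inj,
      exp_eq_exp_iff_exists_int]
    refine ⟨s, ?_⟩
    push_cast
    ring
  · dsimp only
    rw [← exp_add, mul_mul_mul_comm, ← exp_add, neg_mul_neg, I_mul_I, ← exp_pi_mul_I, ← exp_add,
      exp_eq_exp_iff_exists_int]
    refine ⟨s, ?_⟩
    push_cast
    ring

lemma differentiable_theta1 {τ : ℂ} (hτ : 0 < τ.im) : Differentiable ℂ fun z => theta1 z τ := by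
  intro z
  simp only [theta1_eq_jacobiTheta₂ hτ]
  have h := differentiableAt_jacobiTheta₂_fst (z / Real.pi + 1 / 2 + τ / 2) hτ
  have h2 : DifferentiableAt ℂ (fun z : ℂ => jacobiTheta₂ (z / Real.pi + 1 / 2 + τ / 2) τ) z :=
    DifferentiableAt.comp (g := fun z => jacobiTheta₂ z τ) z h (by fun_prop)
  fun_prop

lemma differentiable_thetaEven {τ : ℂ} (hτ : 0 < τ.im) : Differentiable ℂ (thetaEven τ) := by
  intro z
  exact DifferentiableAt.comp (g := fun z => jacobiTheta₂ z (2 * τ)) z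
    (differentiableAt_jacobiTheta₂_fst _ (two_mul_im_pos hτ)) (by fun_prop)

lemma differentiable_thetaOdd {τ : ℂ} (hτ : 0 < τ.im) : Differentiable ℂ (thetaOdd τ) := by
  intro z
  have : DifferentiableAt ℂ (fun x : ℂ => jacobiTheta₂ (2 * x / Real.pi + τ) (2 * τ)) z :=
    DifferentiableAt.comp (g := fun z => jacobiTheta₂ z (2 * τ)) z
      (differentiableAt_jacobiTheta₂_fst _ (two_mul_im_pos hτ)) (by fun_prop)
  unfold thetaOdd
  fun_prop

lemma theta1_zero (τ : ℂ) : theta1 0 τ = 0 := by simp [theta1]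

lemma theta1_neg (z τ : ℂ) : theta1 (-z) τ = -theta1 z τ := by
  simp [theta1, tsum_neg]

lemma deriv_theta1_addition {τ : ℂ} (hτ : 0 < τ.im) (z v : ℂ) :
    deriv (fun z => theta1 z τ) (z + v) * theta1 (z - v) τ +
      theta1 (z + v) τ * deriv (fun z => theta1 z τ) (z - v) =
    deriv (thetaEven τ) z * thetaOdd τ v - deriv (thetaOdd τ) z * thetaEven τ v := by
  have h1 := ((differentiable_theta1 hτ (z + v)).hasDerivAt.comp_add_const z v).mul
    ((differentiable_theta1 hτ (z - v)).hasDerivAt.comp_sub_const z v)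
  have h2 := ((differentiable_thetaEven hτ z).hasDerivAt.mul_const (thetaOdd τ v)).sub
    ((differentiable_thetaOdd hτ z).hasDerivAt.mul_const (thetaEven τ v))
  refine h1.unique (h2.congr_of_eventuallyEq (Eventually.of_forall fun w => ?_))
  exact theta1_addition hτ w v

/-- Differentiate the addition formula in its second variable on the diagonal, where the factor
θ₁(z-w) vanishes. -/
lemma theta1_wronskian {τ : ℂ} (hτ : 0 < τ.im) (z : ℂ) :
    -(theta1 (2 * z) τ * deriv (fun z => theta1 z τ) 0) =
    thetaEven τ z * deriv (thetaOdd τ) z - thetaOdd τ z * deriv (thetaEven τ) z := by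
  have h1 := ((differentiable_theta1 hτ (z + z)).hasDerivAt.comp_const_add z z).mul
    ((differentiable_theta1 hτ (z - z)).hasDerivAt.comp_const_sub z z)
  have h2 := ((differentiable_thetaOdd hτ z).hasDerivAt.const_mul (thetaEven τ z)).sub
    ((differentiable_thetaEven hτ z).hasDerivAt.const_mul (thetaOdd τ z))
  have h3 := h1.unique (h2.congr_of_eventuallyEq
    (Eventually.of_forall fun w => theta1_addition hτ z w))
  rw [← h3, sub_self, theta1_zero, two_mul]
  ring

/-- The logarithmic derivative of `θ₁`. -/
noncomputable def theta1LogDeriv (τ z : ℂ) : ℂ := deriv (fun z => theta1 z τ) z / theta1 z τ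

/-- A four-term relation between logarithmic derivatives of `θ₁`. -/
theorem theta1LogDeriv_four_term {τ : ℂ} (hτ : 0 < τ.im) {z v : ℂ}
    (h1 : theta1 (z + v) τ ≠ 0) (h2 : theta1 (z - v) τ ≠ 0)
    (h3 : theta1 (z + 2 * v) τ ≠ 0) (h4 : theta1 (z - 2 * v) τ ≠ 0) :
    theta1LogDeriv τ (z + v) + theta1LogDeriv τ (z - v) -
      theta1LogDeriv τ (z + 2 * v) - theta1LogDeriv τ (z - 2 * v) =
    -(deriv (fun z => theta1 z τ) 0 * theta1 (2 * z) τ * (theta1 (3 * v) τ * theta1 v τ)) /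
      (theta1 (z + v) τ * theta1 (z - v) τ * (theta1 (z + 2 * v) τ * theta1 (z - 2 * v) τ)) := by
  have a1 := deriv_theta1_addition hτ z v
  have a2 := deriv_theta1_addition hτ z (2 * v)
  have b1 := theta1_addition hτ z v
  have b2 := theta1_addition hτ z (2 * v)
  have c := theta1_wronskian hτ z
  have d := theta1_addition hτ (2 * v) v
  rw [show 2 * v + v = 3 * v by ring, show 2 * v - v = v by ring] at d
  -- The difference after clearing denominators. In terms of E and O it is a product of two 2×2
  -- determinants: the Wronskian at z, and the determinant of the values at v and 2v.
  have key : (deriv (fun z => theta1 z τ) (z + v) * theta1 (z - v) τ +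
      theta1 (z + v) τ * deriv (fun z => theta1 z τ) (z - v)) *
      (theta1 (z + 2 * v) τ * theta1 (z - 2 * v) τ) -
      (theta1 (z + v) τ * theta1 (z - v) τ) *
      (deriv (fun z => theta1 z τ) (z + 2 * v) * theta1 (z - 2 * v) τ +
      theta1 (z + 2 * v) τ * deriv (fun z => theta1 z τ) (z - 2 * v)) =
      -(deriv (fun z => theta1 z τ) 0 * theta1 (2 * z) τ * (theta1 (3 * v) τ * theta1 v τ)) := by
    rw [a1, a2, b1, b2, d]
    linear_combination (thetaOdd τ (2 * v) * thetaEven τ v - thetaEven τ (2 * v) * thetaOdd τ v) * c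
  rw [← key]
  simp only [theta1LogDeriv]
  generalize theta1 (z + v) τ = A at *
  generalize theta1 (z - v) τ = B at *
  generalize theta1 (z + 2 * v) τ = C at *
  generalize theta1 (z - 2 * v) τ = D at *
  field_simp
  ring

/-! ### Lambert series of logarithmic derivatives. -/

lemma multipliableLocallyUniformlyOn_qPoch {q : ℂ} (hq : ‖q‖ < 1) (R : ℝ) :
    MultipliableLocallyUniformlyOn (fun (n : ℕ) x => 1 - q ^ n * x) (Metric.ball 0 R) := by
  have h := ((summable_geometric_of_lt_one (norm_nonneg _) hq).mul_right R
    ).multipliableLocallyUniformlyOn_nat_one_add (f := fun n x => -(q ^ n * x))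
    (K := Metric.ball (0 : ℂ) R) Metric.isOpen_ball
    (Eventually.of_forall fun n x hx => by
      rw [norm_neg, norm_mul, norm_pow]
      exact mul_le_mul_of_nonneg_left (by simpa using (mem_ball_zero_iff.mp hx).le) (by positivity))
    (fun n => by fun_prop)
  simpa only [← sub_eq_add_neg] using h

lemma differentiable_qPoch {q : ℂ} (hq : ‖q‖ < 1) : Differentiable ℂ (qPoch q) := by
  intro x
  have h := (multipliableLocallyUniformlyOn_qPoch hq (‖x‖ + 1)).hasProdLocallyUniformlyOn
  refine (h.differentiableOn (.of_forall fun _ => ?_) Metric.isOpen_ball).differentiableAt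
    (Metric.isOpen_ball.mem_nhds (by simp))
  simpa [Finset.prod_fn] using DifferentiableOn.finsetProd (fun _ _ => by fun_prop)

lemma hasSum_pnat_geometric {y : ℂ} (hy : ‖y‖ < 1) :
    HasSum (fun N : ℕ+ => y ^ (N : ℕ)) (y / (1 - y)) := by
  rw [hasSum_pnat_iff_hasSum_succ (f := fun n => y ^ n)]
  simp only [pow_succ', div_eq_mul_inv]
  exact (hasSum_geometric_of_norm_lt_one hy).mul_left y

/-- Absolute row sums are ‖x‖^N / (1 - ‖q‖^N), at most a constant times ‖x‖^N. This licenses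
interchanging the two summations in the Lambert series. -/
lemma summable_lambert_prod {q x : ℂ} (hq : ‖q‖ < 1) (hx : ‖x‖ < 1) :
    Summable fun a : ℕ+ × ℕ => (q ^ a.2 * x) ^ (a.1 : ℕ) := by
  apply Summable.of_norm
  have h1 : ∀ N : ℕ+, HasSum (fun n : ℕ => ‖(q ^ n * x) ^ (N : ℕ)‖)
      ((1 - ‖q‖ ^ (N : ℕ))⁻¹ * ‖x‖ ^ (N : ℕ)) := by
    intro N
    have h2 : ∀ n : ℕ, ‖(q ^ n * x) ^ (N : ℕ)‖ = (‖q‖ ^ (N : ℕ)) ^ n * ‖x‖ ^ (N : ℕ) := by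
      intro n
      rw [norm_pow, norm_mul, norm_pow]
      ring
    simp only [h2]
    exact (hasSum_geometric_of_lt_one (by positivity)
      (pow_lt_one₀ (norm_nonneg _) hq N.ne_zero)).mul_right _
  rw [summable_prod_of_nonneg (fun _ => norm_nonneg _)]
  refine ⟨fun N => (h1 N).summable, ?_⟩
  simp only [fun N => (h1 N).tsum_eq]
  have hx' : Summable fun N : ℕ+ => (1 - ‖q‖)⁻¹ * ‖x‖ ^ (N : ℕ) := by
    refine Summable.mul_left _ ?_
    exact (summable_pnat_iff_summable_nat (f := fun n => ‖x‖ ^ n)).mpr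
      (summable_geometric_of_lt_one (norm_nonneg _) hx)
  refine hx'.of_nonneg_of_le (fun N => ?_) (fun N => ?_)
  · have := pow_le_one₀ (norm_nonneg _) hq.le (n := (N : ℕ))
    exact mul_nonneg (inv_nonneg.mpr (by linarith)) (by positivity)
  · have := pow_le_of_le_one (norm_nonneg _) hq.le N.ne_zero
    exact mul_le_mul_of_nonneg_right (inv_anti₀ (by linarith) (by linarith)) (by positivity)

/-- The Lambert series of `x ↦ -x (d/dx) log (x; q)_∞`. -/
theorem hasSum_lambert {q x : ℂ} (hq : ‖q‖ < 1) (hx : ‖x‖ < 1) :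
    HasSum (fun N : ℕ+ => x ^ (N : ℕ) / (1 - q ^ (N : ℕ))) (-x * logDeriv (qPoch q) x) := by
  have hF := summable_lambert_prod hq hx
  have hrow : ∀ N : ℕ+, HasSum (fun n : ℕ => (q ^ n * x) ^ (N : ℕ))
      (x ^ (N : ℕ) / (1 - q ^ (N : ℕ))) := by
    intro N
    have h2 : ∀ n : ℕ, (q ^ n * x) ^ (N : ℕ) = (q ^ (N : ℕ)) ^ n * x ^ (N : ℕ) := by
      intro n; ring
    simp only [h2]
    rw [div_eq_inv_mul]
    have hN : ‖q ^ (N : ℕ)‖ < 1 := by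
      rw [norm_pow]
      exact pow_lt_one₀ (norm_nonneg _) hq N.ne_zero
    exact (hasSum_geometric_of_norm_lt_one hN).mul_right (x ^ (N : ℕ))
  have hcol : ∀ n : ℕ, HasSum (fun N : ℕ+ => (q ^ n * x) ^ (N : ℕ))
      (-x * logDeriv (fun y => 1 - q ^ n * y) x) := by
    intro n
    have hn : ‖q ^ n * x‖ < 1 := by
      rw [norm_mul, norm_pow]
      exact (mul_le_of_le_one_left (norm_nonneg _) (pow_le_one₀ (norm_nonneg _) hq.le)).trans_lt hx
    have hd : HasDerivAt (fun y => 1 - q ^ n * y) (-q ^ n) x := by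
      simpa using ((hasDerivAt_id x).const_mul (q ^ n)).const_sub 1
    have h := hasSum_pnat_geometric hn
    rw [logDeriv_apply, hd.deriv]
    convert h using 1
    ring
  have h1 := hF.hasSum.prod_fiberwise hrow
  have h2 := (hF.prod_symm.hasSum).prod_fiberwise hcol
  have h3 : ∑' b : ℕ × ℕ+, (q ^ b.swap.2 * x) ^ (b.swap.1 : ℕ) =
      ∑' a : ℕ+ × ℕ, (q ^ a.2 * x) ^ (a.1 : ℕ) :=
    (Equiv.prodComm ℕ ℕ+).tsum_eq (fun a : ℕ+ × ℕ => (q ^ a.2 * x) ^ (a.1 : ℕ))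
  rw [← h3, ← h2.tsum_eq, tsum_mul_left] at h1
  -- Summability of the logarithmic derivatives comes from the column sums by dividing by -x, so x =
  -- 0 is treated apart.
  by_cases hx0 : x = 0
  · subst hx0
    simp
  have hs : Summable fun n : ℕ => logDeriv (fun y => 1 - q ^ n * y) x :=
    (summable_mul_left_iff (neg_ne_zero.mpr hx0)).mp h2.summable
  have h4 := logDeriv_tprod_eq_tsum (f := fun (n : ℕ) y => 1 - q ^ n * y) Metric.isOpen_ball
    (s := Metric.ball (0 : ℂ) 1) (by simpa using hx) (one_sub_pow_mul_ne_zero hq hx)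
    (fun n => by fun_prop) hs (multipliableLocallyUniformlyOn_qPoch hq 1)
    (qPoch_ne_zero_of_norm_lt_one hq hx)
  rwa [← h4] at h1

lemma norm_q (τ : ℂ) : ‖q τ‖ = Real.exp (-(2 * Real.pi * τ.im)) := by
  rw [q, norm_exp]
  simp

lemma norm_exp_two_I_mul (z : ℂ) : ‖cexp (2 * I * z)‖ = Real.exp (-(2 * z.im)) := by
  rw [norm_exp]
  simp

lemma norm_q_mul_exp_lt_one {τ z : ℂ} (hz : -(Real.pi * τ.im) < z.im) :
    ‖q τ * cexp (2 * I * z)‖ < 1 := by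
  rw [norm_mul, norm_q, norm_exp_two_I_mul, ← Real.exp_add, Real.exp_lt_one_iff]
  linarith

lemma norm_q_mul_exp_neg_lt_one {τ z : ℂ} (hz : z.im < Real.pi * τ.im) :
    ‖q τ * cexp (-(2 * I * z))‖ < 1 := by
  rw [← mul_neg]
  exact norm_q_mul_exp_lt_one (by simpa using hz)

lemma eta_eq (τ : ℂ) :
    ModularForm.eta τ = cexp (2 * Real.pi * I * τ / 24) * qPoch (q τ) (q τ) := by
  rw [ModularForm.eta, qPoch]
  simp only [q, pow_succ, Function.Periodic.qParam]
  norm_num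

lemma eta_ne_zero' {τ : ℂ} (hτ : 0 < τ.im) : ModularForm.eta τ ≠ 0 :=
  ModularForm.eta_ne_zero hτ

/-- `θ₁` does not vanish in the open strip around the real axis, except on the real axis. -/
lemma theta1_ne_zero {τ z : ℂ} (hτ : 0 < τ.im) (hz : |z.im| < Real.pi * τ.im) (hs : sin z ≠ 0) :
    theta1 z τ ≠ 0 := by
  have hq := norm_q_lt_one hτ
  obtain ⟨h1, h2⟩ := abs_lt.mp hz
  rw [theta1_eq_prod hτ]
  exact mul_ne_zero (mul_ne_zero (mul_ne_zero (mul_ne_zero (mul_ne_zero two_ne_zero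
    (exp_ne_zero _)) hs) (qPoch_ne_zero_of_norm_lt_one hq (norm_q_mul_exp_lt_one h1)))
    (qPoch_ne_zero_of_norm_lt_one hq (norm_q_mul_exp_neg_lt_one h2)))
    (qPoch_ne_zero_of_norm_lt_one hq hq)

lemma hasDerivAt_exp_two_I (c z : ℂ) :
    HasDerivAt (fun z => c * cexp (2 * I * z)) (2 * I * (c * cexp (2 * I * z))) z := by
  have h := (((hasDerivAt_id z).const_mul (2 * I)).cexp).const_mul c
  exact h.congr_deriv (by simp only [id, mul_one]; ring)

lemma hasDerivAt_exp_neg_two_I (c z : ℂ) :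
    HasDerivAt (fun z => c * cexp (-(2 * I * z))) (-(2 * I * (c * cexp (-(2 * I * z))))) z := by
  have h := ((((hasDerivAt_id z).const_mul (2 * I)).neg).cexp).const_mul c
  exact h.congr_deriv (by simp only [id, mul_one, Pi.neg_apply]; ring)

lemma hasDerivAt_theta1 {τ : ℂ} (hτ : 0 < τ.im) (z : ℂ) :
    HasDerivAt (fun z => theta1 z τ)
      (2 * cexp (2 * Real.pi * I * τ / 8) *
        (cos z * (qPoch (q τ) (q τ * cexp (2 * I * z)) * qPoch (q τ) (q τ * cexp (-(2 * I * z)))) +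
          sin z * (deriv (qPoch (q τ)) (q τ * cexp (2 * I * z)) * (2 * I * (q τ * cexp (2 * I * z))) *
            qPoch (q τ) (q τ * cexp (-(2 * I * z))) + qPoch (q τ) (q τ * cexp (2 * I * z)) *
            (deriv (qPoch (q τ)) (q τ * cexp (-(2 * I * z))) *
              (-(2 * I * (q τ * cexp (-(2 * I * z)))))))) *
        qPoch (q τ) (q τ)) z := by
  have hd := differentiable_qPoch (norm_q_lt_one hτ)
  have h1 := ((hd (q τ * cexp (2 * I * z))).hasDerivAt).comp z (hasDerivAt_exp_two_I (q τ) z)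
  have h2 := ((hd (q τ * cexp (-(2 * I * z)))).hasDerivAt).comp z
    (hasDerivAt_exp_neg_two_I (q τ) z)
  have h3 := (((hasDerivAt_sin z).mul (h1.mul h2)).const_mul
    (2 * cexp (2 * Real.pi * I * τ / 8))).mul_const (qPoch (q τ) (q τ))
  refine h3.congr_of_eventuallyEq (Eventually.of_forall fun w => ?_)
  simp only [Function.comp, Pi.mul_apply]
  rw [theta1_eq_prod hτ]
  ring

/-- `θ₁'(0) = 2 η³`. -/
theorem deriv_theta1_zero {τ : ℂ} (hτ : 0 < τ.im) :
    deriv (fun z => theta1 z τ) 0 = 2 * ModularForm.eta τ ^ 3 := by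
  rw [(hasDerivAt_theta1 hτ 0).deriv, eta_eq, mul_pow, ← exp_nat_mul]
  simp only [sin_zero, cos_zero, zero_mul, mul_zero, neg_zero, exp_zero, mul_one, one_mul, add_zero]
  rw [show ((3 : ℕ) : ℂ) * (2 * Real.pi * I * τ / 24) = 2 * Real.pi * I * τ / 8 by push_cast; ring]
  ring

lemma theta1LogDeriv_neg {τ : ℂ} (z : ℂ) : theta1LogDeriv τ (-z) = -theta1LogDeriv τ z := by
  have h : deriv (fun z => theta1 z τ) (-z) = deriv (fun z => theta1 z τ) z := by
    have h1 := deriv_comp_neg (fun z => theta1 z τ) z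
    simp only [theta1_neg, deriv.fun_neg] at h1
    linear_combination h1
  rw [theta1LogDeriv, theta1LogDeriv, h, theta1_neg, div_neg]

lemma theta1LogDeriv_eq {τ z : ℂ} (hτ : 0 < τ.im) (hs : sin z ≠ 0)
    (h1 : qPoch (q τ) (q τ * cexp (2 * I * z)) ≠ 0)
    (h2 : qPoch (q τ) (q τ * cexp (-(2 * I * z))) ≠ 0) :
    theta1LogDeriv τ z = cos z / sin z -
      2 * I * (-(q τ * cexp (2 * I * z)) * logDeriv (qPoch (q τ)) (q τ * cexp (2 * I * z))) +
      2 * I * (-(q τ * cexp (-(2 * I * z))) *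
        logDeriv (qPoch (q τ)) (q τ * cexp (-(2 * I * z)))) := by
  have hq := norm_q_lt_one hτ
  have h3 := qPoch_ne_zero_of_norm_lt_one hq hq
  have h4 := exp_ne_zero (2 * Real.pi * I * τ / 8)
  rw [theta1LogDeriv, (hasDerivAt_theta1 hτ z).deriv, theta1_eq_prod hτ, logDeriv_apply,
    logDeriv_apply]
  generalize qPoch (q τ) (q τ * cexp (2 * I * z)) = A at *
  generalize qPoch (q τ) (q τ * cexp (-(2 * I * z))) = B at *
  generalize qPoch (q τ) (q τ) = C at *
  generalize deriv (qPoch (q τ)) (q τ * cexp (2 * I * z)) = A' at *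
  generalize deriv (qPoch (q τ)) (q τ * cexp (-(2 * I * z))) = B' at *
  generalize q τ * cexp (2 * I * z) = x at *
  generalize q τ * cexp (-(2 * I * z)) = y at *
  field_simp
  ring

lemma one_sub_pow_ne_zero {q : ℂ} (hq : ‖q‖ < 1) {n : ℕ} (hn : n ≠ 0) : 1 - q ^ n ≠ 0 := by
  obtain ⟨k, rfl⟩ := Nat.exists_eq_succ_of_ne_zero hn
  simpa only [pow_succ] using one_sub_pow_mul_ne_zero hq hq k

/-- The Lambert series of the logarithmic derivative of `θ₁` in the strip around the real axis. -/
theorem hasSum_theta1LogDeriv_sub_cot {τ z : ℂ} (hτ : 0 < τ.im) (hz : |z.im| < Real.pi * τ.im)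
    (hs : sin z ≠ 0) :
    HasSum (fun n : ℕ+ => 4 * (q τ ^ (n : ℕ) / (1 - q τ ^ (n : ℕ))) * sin (2 * (n : ℕ) * z))
      (theta1LogDeriv τ z - cos z / sin z) := by
  have hq := norm_q_lt_one hτ
  obtain ⟨h1, h2⟩ := abs_lt.mp hz
  have h1 := norm_q_mul_exp_lt_one h1
  have h2 := norm_q_mul_exp_neg_lt_one h2
  rw [theta1LogDeriv_eq hτ hs (qPoch_ne_zero_of_norm_lt_one hq h1)
    (qPoch_ne_zero_of_norm_lt_one hq h2)]
  have h3 := ((hasSum_lambert hq h2).mul_left (2 * I)).sub ((hasSum_lambert hq h1).mul_left (2 * I))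
  convert hasSum_of_eq h3 (fun n => ?_) using 1
  · ring
  · rw [mul_pow, mul_pow, ← exp_nat_mul, ← exp_nat_mul, sin,
      show -(2 * ((n : ℕ) : ℂ) * z) * I = (n : ℕ) * -(2 * I * z) by ring,
      show 2 * ((n : ℕ) : ℂ) * z * I = (n : ℕ) * (2 * I * z) by ring]
    ring

/-- Logarithmic derivative of (x; q)_∞ = (1 - x)(qx; q)_∞. It moves the expansion from q e^{2iz} to
e^{2iz}, which is small above the real axis. -/
lemma lambert_recurrence {q x : ℂ} (hq : ‖q‖ < 1) (hx : 1 - x ≠ 0) (h : qPoch q (q * x) ≠ 0) :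
    -x * logDeriv (qPoch q) x = x / (1 - x) + -(q * x) * logDeriv (qPoch q) (q * x) := by
  have h1 : HasDerivAt (fun y => 1 - y) (-1) x := by
    simpa using (hasDerivAt_id x).const_sub 1
  have h2 := ((differentiable_qPoch hq (q * x)).hasDerivAt).comp x
    ((hasDerivAt_id x).const_mul q)
  have h3 := (h1.mul h2).congr_of_eventuallyEq
    (Eventually.of_forall fun y => qPoch_eq_mul hq y)
  rw [logDeriv_apply, logDeriv_apply, h3.deriv, qPoch_eq_mul hq x]
  simp only [Function.comp]
  generalize qPoch q (q * x) = A at *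
  generalize deriv (qPoch q) (q * x) = B at *
  field_simp
  ring

/-- The Lambert series of the logarithmic derivative of `θ₁` in the strip above the real axis. -/
theorem hasSum_theta1LogDeriv_add_I {τ z : ℂ} (hτ : 0 < τ.im) (hz0 : 0 < z.im)
    (hz1 : z.im < Real.pi * τ.im) :
    HasSum (fun n : ℕ+ => -2 * I * (cexp ((n : ℕ) * (2 * I * z)) -
      q τ ^ (n : ℕ) * cexp (-((n : ℕ) * (2 * I * z)))) / (1 - q τ ^ (n : ℕ)))
      (theta1LogDeriv τ z + I) := by
  have hq := norm_q_lt_one hτ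
  have h0 : ‖cexp (2 * I * z)‖ < 1 := by
    rw [norm_exp_two_I_mul, Real.exp_lt_one_iff]
    linarith
  have h1 : ‖q τ * cexp (2 * I * z)‖ < 1 :=
    norm_q_mul_exp_lt_one ((neg_lt_zero.mpr (hz0.trans hz1)).trans hz0)
  have h2 := norm_q_mul_exp_neg_lt_one hz1
  have hw : 1 - cexp (2 * I * z) ≠ 0 := by
    simpa using one_sub_pow_mul_ne_zero hq h0 0
  have hw2 : 1 - cexp (2 * I * z) = -(cexp (I * z) * (2 * I * sin z)) := by
    simpa using one_sub_exp_inv (-z)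
  have hs : sin z ≠ 0 := by
    intro h
    rw [hw2, h] at hw
    simp at hw
  have h3 := ((hasSum_lambert hq h2).mul_left (2 * I)).sub ((hasSum_lambert hq h0).mul_left (2 * I))
  rw [lambert_recurrence hq hw (qPoch_ne_zero_of_norm_lt_one hq h1)] at h3
  rw [theta1LogDeriv_eq hτ hs (qPoch_ne_zero_of_norm_lt_one hq h1)
    (qPoch_ne_zero_of_norm_lt_one hq h2)]
  convert hasSum_of_eq h3 (fun n => ?_) using 1
  -- The cotangent plus i is -2iw/(1-w) with w = e^{2iz}: exactly the extra term of the recurrence.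
  · have hc : cos z / sin z + I = -(2 * I * (cexp (2 * I * z) / (1 - cexp (2 * I * z)))) := by
      have h5 : cos z + I * sin z = cexp (I * z) := by
        rw [mul_comm I z, exp_mul_I]; ring
      have h6 : cexp (2 * I * z) = cexp (I * z) * cexp (I * z) := by
        rw [← exp_add]; ring_nf
      rw [hw2, h6]
      have := I_ne_zero
      field_simp
      linear_combination h5
    linear_combination hc
  · rw [mul_pow, ← exp_nat_mul, ← exp_nat_mul,
      show ((n : ℕ) : ℂ) * -(2 * I * z) = -((n : ℕ) * (2 * I * z)) by ring]
    ring

/-! ### The shift v = π/5 and the first identity. -/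

/-- `√5` as a complex number. -/
noncomputable def sqrtFive : ℂ := (Real.sqrt 5 : ℝ)

lemma sqrtFive_sq : sqrtFive ^ 2 = 5 := by
  rw [sqrtFive, ← ofReal_pow, Real.sq_sqrt (by norm_num)]
  norm_num

lemma sqrtFive_ne_zero : sqrtFive ≠ 0 := by
  intro h
  have := sqrtFive_sq
  rw [h] at this
  norm_num at this

lemma cos_pi_div_five : cos ((Real.pi : ℂ) / 5) = (1 + sqrtFive) / 4 := by
  have h := congrArg (fun x : ℝ => (x : ℂ)) Real.cos_pi_div_five
  push_cast at h
  exact h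

lemma cos_two_pi_div_five : cos (2 * ((Real.pi : ℂ) / 5)) = (sqrtFive - 1) / 4 := by
  rw [cos_two_mul, cos_pi_div_five]
  linear_combination (1 / 8) * sqrtFive_sq

lemma cos_four_pi_div_five : cos (2 * (2 * ((Real.pi : ℂ) / 5))) = -(sqrtFive + 1) / 4 := by
  rw [cos_two_mul, cos_two_pi_div_five]
  linear_combination (1 / 8) * sqrtFive_sq

lemma sin_sq_pi_div_five : sin ((Real.pi : ℂ) / 5) ^ 2 = (5 - sqrtFive) / 8 := by
  rw [sin_sq, cos_pi_div_five]
  linear_combination (-1 / 16) * sqrtFive_sq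

lemma sin_sq_two_pi_div_five : sin (2 * ((Real.pi : ℂ) / 5)) ^ 2 = (5 + sqrtFive) / 8 := by
  rw [sin_sq, cos_two_pi_div_five]
  linear_combination (-1 / 16) * sqrtFive_sq

lemma sin_add_mul_sin_sub (z v : ℂ) : sin (z + v) * sin (z - v) = sin z ^ 2 - sin v ^ 2 := by
  rw [sin_add, sin_sub]
  linear_combination sin z ^ 2 * cos_sq_add_sin_sq v - sin v ^ 2 * cos_sq_add_sin_sq z

lemma sin_five_mul (z : ℂ) : sin (5 * z) = 16 * sin z ^ 5 - 20 * sin z ^ 3 + 5 * sin z := by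
  rw [show 5 * z = 3 * z + 2 * z by ring, sin_add, sin_three_mul, cos_three_mul, sin_two_mul,
    cos_two_mul]
  have h := cos_sq' z
  have h4 : cos z ^ 4 = (1 - sin z ^ 2) ^ 2 := by rw [← h]; ring
  linear_combination 8 * sin z * h4 + (6 * sin z - 8 * sin z ^ 3 - 6 * sin z) * h

lemma sin_five_prod (z : ℂ) :
    sin z * (sin (z + Real.pi / 5) * sin (z - Real.pi / 5) *
      (sin (z + 2 * (Real.pi / 5)) * sin (z - 2 * (Real.pi / 5)))) = sin (5 * z) / 16 := by
  rw [sin_add_mul_sin_sub, sin_add_mul_sin_sub, sin_sq_pi_div_five, sin_sq_two_pi_div_five,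
    sin_five_mul]
  linear_combination (-sin z / 64) * sqrtFive_sq

lemma cos_two_pi_mul_div_five (n : ℕ) :
    cos (2 * n * ((Real.pi : ℂ) / 5)) = cos (2 * (n % 5 : ℕ) * ((Real.pi : ℂ) / 5)) := by
  have h : (n : ℂ) = 5 * (n / 5 : ℕ) + (n % 5 : ℕ) := by
    exact_mod_cast (Nat.div_add_mod n 5).symm
  rw [← cos_add_nat_mul_two_pi (2 * (n % 5 : ℕ) * ((Real.pi : ℂ) / 5)) (n / 5)]
  congr 1
  rw [h]
  ring

/-- The quadratic Gauss sum mod 5, with the residues ±1 and ±2 paired into cosines. Both sides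
depend on n mod 5 only, leaving five cases. -/
lemma chi5_gauss (n : ℕ+) : sqrtFive * chi5 n =
    2 * (cos (2 * (n : ℕ) * ((Real.pi : ℂ) / 5)) -
      cos (2 * (n : ℕ) * (2 * ((Real.pi : ℂ) / 5)))) := by
  have h3 : cos (2 * (3 : ℕ) * ((Real.pi : ℂ) / 5)) = cos (2 * (2 * ((Real.pi : ℂ) / 5))) := by
    rw [← cos_two_pi_sub]
    congr 1
    push_cast
    ring
  have h4 : cos (2 * (4 : ℕ) * ((Real.pi : ℂ) / 5)) = cos (2 * ((Real.pi : ℂ) / 5)) := by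
    rw [← cos_two_pi_sub]
    congr 1
    push_cast
    ring
  have h2 : cos (2 * (2 : ℕ) * ((Real.pi : ℂ) / 5)) = cos (2 * (2 * ((Real.pi : ℂ) / 5))) := by
    congr 1
    push_cast
    ring
  have h1 : cos (2 * (1 : ℕ) * ((Real.pi : ℂ) / 5)) = cos (2 * ((Real.pi : ℂ) / 5)) := by
    congr 1
    push_cast
    ring
  have h0 : cos (2 * (0 : ℕ) * ((Real.pi : ℂ) / 5)) = 1 := by simp
  have e : 2 * ((n : ℕ) : ℂ) * (2 * ((Real.pi : ℂ) / 5)) =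
      2 * (2 * (n : ℕ) : ℕ) * ((Real.pi : ℂ) / 5) := by
    push_cast
    ring
  rw [e, cos_two_pi_mul_div_five n, cos_two_pi_mul_div_five (2 * (n : ℕ)), chi5, legendreSym.mod]
  have hlt : (n : ℕ) % 5 < 5 := Nat.mod_lt _ (by norm_num)
  have hm : 2 * (n : ℕ) % 5 = 2 * ((n : ℕ) % 5) % 5 := by omega
  have hc : (((n : ℕ) : ℤ) % (5 : ℕ)) = (((n : ℕ) % 5 : ℕ) : ℤ) := by push_cast; rfl
  rw [hm, hc]
  generalize (n : ℕ) % 5 = r at *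
  have l0 : legendreSym 5 (0 : ℕ) = 0 := by decide
  have l1 : legendreSym 5 (1 : ℕ) = 1 := by decide
  have l2 : legendreSym 5 (2 : ℕ) = -1 := by decide
  have l3 : legendreSym 5 (3 : ℕ) = -1 := by decide
  have l4 : legendreSym 5 (4 : ℕ) = 1 := by decide
  interval_cases r <;>
    simp only [l0, l1, l2, l3, l4, h0, h1, h2, h3, h4, cos_two_pi_div_five,
      cos_four_pi_div_five, Nat.reduceMul, Nat.reduceMod, Int.cast_one, Int.cast_neg, Int.cast_zero]
  all_goals ring

lemma norm_pow_five_lt_one {q : ℂ} (hq : ‖q‖ < 1) : ‖q ^ 5‖ < 1 := by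
  rw [norm_pow]
  exact pow_lt_one₀ (norm_nonneg _) hq (by norm_num)

lemma one_sub_mul_exp_prod (y a : ℂ) :
    (1 - y * cexp (2 * I * a)) * (1 - y * cexp (-(2 * I * a))) = 1 - 2 * y * cos (2 * a) + y ^ 2 := by
  have h : cexp (2 * I * a) * cexp (-(2 * I * a)) = 1 := by rw [← exp_add]; simp
  rw [cos, show 2 * a * I = 2 * I * a by ring, show -(2 * a) * I = -(2 * I * a) by ring]
  linear_combination y ^ 2 * h

/-- Multisection of `(x; q)_∞` over the fifth roots of unity. -/
lemma qPoch_roots_of_unity {q : ℂ} (hq : ‖q‖ < 1) (x : ℂ) :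
    qPoch q x * (qPoch q (x * cexp (2 * I * (Real.pi / 5))) *
      qPoch q (x * cexp (-(2 * I * (Real.pi / 5)))) *
      (qPoch q (x * cexp (2 * I * (2 * (Real.pi / 5)))) *
      qPoch q (x * cexp (-(2 * I * (2 * (Real.pi / 5))))))) = qPoch (q ^ 5) (x ^ 5) := by
  have h := (tendsto_qPoch hq x).mul
    (((tendsto_qPoch hq (x * cexp (2 * I * (Real.pi / 5)))).mul
      (tendsto_qPoch hq (x * cexp (-(2 * I * (Real.pi / 5)))))).mul
      ((tendsto_qPoch hq (x * cexp (2 * I * (2 * (Real.pi / 5))))).mul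
      (tendsto_qPoch hq (x * cexp (-(2 * I * (2 * (Real.pi / 5))))))))
  simp only [← Finset.prod_mul_distrib] at h
  refine tendsto_nhds_unique (h.congr fun n => Finset.prod_congr rfl fun j _ => ?_)
    (tendsto_qPoch (norm_pow_five_lt_one hq) (x ^ 5))
  simp only [← mul_assoc (q ^ j)]
  -- Conjugate roots are paired, so this is the factorization of 1 - y⁵ over ℚ(√5).
  rw [one_sub_mul_exp_prod, one_sub_mul_exp_prod, cos_two_pi_div_five, cos_four_pi_div_five]
  rw [show (q ^ 5) ^ j * x ^ 5 = (q ^ j * x) ^ 5 by ring]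
  generalize q ^ j * x = y
  linear_combination ((1 - y) * (-y ^ 2 / 4)) * sqrtFive_sq

lemma q_five_mul (τ : ℂ) : q (5 * τ) = q τ ^ 5 := by
  rw [q, q, ← exp_nat_mul]
  congr 1
  push_cast
  ring

lemma five_mul_im_pos {τ : ℂ} (hτ : 0 < τ.im) : 0 < (5 * τ).im := by
  simpa using hτ

/-- In the product expansions the sines multiply by `sin_five_prod` and the infinite products by
`qPoch_roots_of_unity`; the z-free factors account for the eta functions. -/
lemma theta1_prod_real_shift {τ : ℂ} (hτ : 0 < τ.im) (z : ℂ) :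
    theta1 z τ * (theta1 (z + Real.pi / 5) τ * theta1 (z - Real.pi / 5) τ *
      (theta1 (z + 2 * (Real.pi / 5)) τ * theta1 (z - 2 * (Real.pi / 5)) τ)) *
      ModularForm.eta (5 * τ) = theta1 (5 * z) (5 * τ) * ModularForm.eta τ ^ 5 := by
  have hq := norm_q_lt_one hτ
  have e1 : ∀ v : ℂ, cexp (2 * I * (z + v)) = cexp (2 * I * z) * cexp (2 * I * v) := by
    intro v; rw [← exp_add]; ring_nf
  have e2 : ∀ v : ℂ, cexp (2 * I * (z - v)) = cexp (2 * I * z) * cexp (-(2 * I * v)) := by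
    intro v; rw [← exp_add]; ring_nf
  have e3 : ∀ v : ℂ, cexp (-(2 * I * (z + v))) = cexp (-(2 * I * z)) * cexp (-(2 * I * v)) := by
    intro v; rw [← exp_add]; ring_nf
  have e4 : ∀ v : ℂ, cexp (-(2 * I * (z - v))) = cexp (-(2 * I * z)) * cexp (2 * I * v) := by
    intro v; rw [← exp_add]; ring_nf
  have e5 : cexp (2 * I * (5 * z)) = cexp (2 * I * z) ^ 5 := by
    rw [← exp_nat_mul]; push_cast; ring_nf
  have e6 : cexp (-(2 * I * (5 * z))) = cexp (-(2 * I * z)) ^ 5 := by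
    rw [← exp_nat_mul]; push_cast; ring_nf
  have e7 : cexp (2 * Real.pi * I * (5 * τ) / 8) = cexp (2 * Real.pi * I * τ / 8) ^ 5 := by
    rw [← exp_nat_mul]; push_cast; ring_nf
  have e8 : cexp (2 * Real.pi * I * (5 * τ) / 24) = cexp (2 * Real.pi * I * τ / 24) ^ 5 := by
    rw [← exp_nat_mul]; push_cast; ring_nf
  have h1 := qPoch_roots_of_unity hq (q τ * cexp (2 * I * z))
  have h2 := qPoch_roots_of_unity hq (q τ * cexp (-(2 * I * z)))
  have h3 := sin_five_prod z
  have h4 : 32 * (cexp (2 * Real.pi * I * τ / 8) ^ 5 * cexp (2 * Real.pi * I * τ / 24) ^ 5 *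
      qPoch (q τ) (q τ) ^ 5 * qPoch (q τ ^ 5) (q τ ^ 5)) *
      (qPoch (q τ ^ 5) ((q τ * cexp (2 * I * z)) ^ 5) *
      qPoch (q τ ^ 5) ((q τ * cexp (-(2 * I * z))) ^ 5)) * _ = _ * _ := congrArg _ h3
  simp only [theta1_eq_prod hτ, theta1_eq_prod (five_mul_im_pos hτ), eta_eq, q_five_mul, e1, e2, e3,
    e4, e5, e6, e7, e8, ← mul_assoc (q τ), ← mul_pow, ← h1, ← h2] at h4 ⊢
  linear_combination h4

/-- The phases e^{±2πi/5}, e^{±4πi/5} supply the four twisted factors that complete (q; q)_∞ to (q⁵;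
q⁵)_∞. -/
lemma theta1_special_real {τ : ℂ} (hτ : 0 < τ.im) :
    theta1 (3 * (Real.pi / 5)) τ * theta1 (Real.pi / 5) τ =
      sqrtFive * (ModularForm.eta τ * ModularForm.eta (5 * τ)) := by
  have hq := norm_q_lt_one hτ
  have hs : sin (3 * ((Real.pi : ℂ) / 5)) * sin ((Real.pi : ℂ) / 5) = sqrtFive / 4 := by
    have h := sin_add_mul_sin_sub (2 * ((Real.pi : ℂ) / 5)) (Real.pi / 5)
    rw [sin_sq_pi_div_five, sin_sq_two_pi_div_five,
      show 2 * ((Real.pi : ℂ) / 5) + Real.pi / 5 = 3 * (Real.pi / 5) by ring,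
      show 2 * ((Real.pi : ℂ) / 5) - Real.pi / 5 = Real.pi / 5 by ring] at h
    linear_combination h
  have e1 : cexp (2 * I * (3 * ((Real.pi : ℂ) / 5))) =
      cexp (-(2 * I * (2 * ((Real.pi : ℂ) / 5)))) := by
    rw [exp_eq_exp_iff_exists_int]
    exact ⟨1, by push_cast; ring⟩
  have e2 : cexp (-(2 * I * (3 * ((Real.pi : ℂ) / 5)))) =
      cexp (2 * I * (2 * ((Real.pi : ℂ) / 5))) := by
    rw [exp_eq_exp_iff_exists_int]
    exact ⟨-1, by push_cast; ring⟩
  have e8 : cexp (2 * Real.pi * I * τ / 8) ^ 2 =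
      cexp (2 * Real.pi * I * τ / 24) * cexp (2 * Real.pi * I * (5 * τ) / 24) := by
    rw [← exp_nat_mul, ← exp_add]; push_cast; ring_nf
  have h1 := qPoch_roots_of_unity hq (q τ)
  have h2 : 4 * cexp (2 * Real.pi * I * τ / 8) ^ 2 * qPoch (q τ) (q τ) *
    qPoch (q τ ^ 5) (q τ ^ 5) * _ = _ * _ := congrArg _ hs
  simp only [theta1_eq_prod hτ, eta_eq, q_five_mul, e1, e2, ← h1] at h2 ⊢
  linear_combination h2 + sqrtFive * qPoch (q τ) (q τ) * (qPoch (q τ) (q τ) *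
    (qPoch (q τ) (q τ * cexp (2 * I * (Real.pi / 5))) *
      qPoch (q τ) (q τ * cexp (-(2 * I * (Real.pi / 5)))) *
      (qPoch (q τ) (q τ * cexp (2 * I * (2 * (Real.pi / 5)))) *
      qPoch (q τ) (q τ * cexp (-(2 * I * (2 * (Real.pi / 5)))))))) * e8

lemma theta1_five_ne_zero {τ z : ℂ} (hτ : 0 < τ.im) (hz : |z.im| < Real.pi * τ.im)
    (hs : sin (5 * z) ≠ 0) : theta1 (5 * z) (5 * τ) ≠ 0 := by
  refine theta1_ne_zero (five_mul_im_pos hτ) ?_ hs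
  have h : (5 * z).im = 5 * z.im := by simp
  have h2 : (5 * τ).im = 5 * τ.im := by simp
  rw [h, h2, abs_mul, abs_of_pos (by norm_num : (0 : ℝ) < 5)]
  linarith

/-- Each pair of cotangents is sin 2z over sin²z - sin²v. In the difference sin²z cancels, leaving
the constant sin²(π/5) - sin²(2π/5) = -√5/4. -/
lemma cot_four_term {z : ℂ} (hs : sin (5 * z) ≠ 0) :
    cos (z + Real.pi / 5) / sin (z + Real.pi / 5) + cos (z - Real.pi / 5) / sin (z - Real.pi / 5) -
      cos (z + 2 * (Real.pi / 5)) / sin (z + 2 * (Real.pi / 5)) -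
      cos (z - 2 * (Real.pi / 5)) / sin (z - 2 * (Real.pi / 5)) =
    -4 * sqrtFive * (sin z * sin (2 * z) / sin (5 * z)) := by
  have h := sin_five_prod z
  have hne : sin z * (sin (z + Real.pi / 5) * sin (z - Real.pi / 5) *
      (sin (z + 2 * (Real.pi / 5)) * sin (z - 2 * (Real.pi / 5)))) ≠ 0 := by
    rw [h]; exact div_ne_zero hs (by norm_num)
  have h5 : sin (5 * z) = 16 * (sin z * (sin (z + Real.pi / 5) * sin (z - Real.pi / 5) *
      (sin (z + 2 * (Real.pi / 5)) * sin (z - 2 * (Real.pi / 5))))) := by rw [h]; ring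
  have hc : ∀ v : ℂ, cos (z + v) * sin (z - v) + cos (z - v) * sin (z + v) = sin (2 * z) := by
    intro v
    rw [show 2 * z = (z + v) + (z - v) by ring, sin_add (z + v)]
    ring
  have h1 := hc (Real.pi / 5)
  have h2 := hc (2 * (Real.pi / 5))
  have h3 := sin_add_mul_sin_sub z (Real.pi / 5)
  have h4 := sin_add_mul_sin_sub z (2 * (Real.pi / 5))
  rw [sin_sq_pi_div_five] at h3
  rw [sin_sq_two_pi_div_five] at h4
  rw [h5]
  simp only [mul_ne_zero_iff] at hne
  obtain ⟨n0, ⟨n1, n2⟩, n3, n4⟩ := hne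
  generalize sin (z + Real.pi / 5) = a at *
  generalize sin (z - Real.pi / 5) = b at *
  generalize sin (z + 2 * (Real.pi / 5)) = c at *
  generalize sin (z - 2 * (Real.pi / 5)) = d at *
  generalize cos (z + Real.pi / 5) = a' at *
  generalize cos (z - Real.pi / 5) = b' at *
  generalize cos (z + 2 * (Real.pi / 5)) = c' at *
  generalize cos (z - 2 * (Real.pi / 5)) = d' at *
  field_simp
  linear_combination 16 * (c * d * h1 - a * b * h2 + sin (2 * z) * (h4 - h3))

lemma theta1LogDeriv_real_shift {τ z : ℂ} (hτ : 0 < τ.im) (hz : |z.im| < Real.pi * τ.im)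
    (hs : sin (5 * z) ≠ 0) :
    theta1LogDeriv τ (z + Real.pi / 5) + theta1LogDeriv τ (z - Real.pi / 5) -
      theta1LogDeriv τ (z + 2 * (Real.pi / 5)) - theta1LogDeriv τ (z - 2 * (Real.pi / 5)) =
    -4 * sqrtFive * quotientA τ z := by
  have h5 := theta1_five_ne_zero hτ hz hs
  have he := eta_ne_zero' hτ
  have he5 := eta_ne_zero' (five_mul_im_pos hτ)
  have hp := theta1_prod_real_shift hτ z
  -- The right side of the product formula is nonzero, hence so is every shifted theta value.
  have hne := hp.symm ▸ mul_ne_zero h5 (pow_ne_zero 5 he)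
  simp only [mul_ne_zero_iff] at hne
  obtain ⟨⟨n0, ⟨n1, n2⟩, n3, n4⟩, -⟩ := hne
  rw [theta1LogDeriv_four_term hτ n1 n2 n3 n4, deriv_theta1_zero hτ, theta1_special_real hτ,
    quotientA]
  generalize theta1 (z + Real.pi / 5) τ = a at *
  generalize theta1 (z - Real.pi / 5) τ = b at *
  generalize theta1 (z + 2 * (Real.pi / 5)) τ = c at *
  generalize theta1 (z - 2 * (Real.pi / 5)) τ = d at *
  generalize theta1 (5 * z) (5 * τ) = t at *
  generalize ModularForm.eta (5 * τ) = e5 at *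
  generalize ModularForm.eta τ = e at *
  field_simp
  linear_combination 4 * sqrtFive * theta1 (2 * z) τ * hp

/-- Real shifts stay in the strip, so the expansion about the cotangent applies four times. Adding
±v gives 2 sin(2nz) cos(2nv), and `chi5_gauss` collapses the cosines. -/
lemma hasSum_termA {τ z : ℂ} (hτ : 0 < τ.im) (hz : |z.im| < Real.pi * τ.im)
    (hs : sin (5 * z) ≠ 0) :
    HasSum (termA τ z) (sin z * sin (2 * z) / sin (5 * z) - quotientA τ z) := by
  have hne : sin z * (sin (z + Real.pi / 5) * sin (z - Real.pi / 5) *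
      (sin (z + 2 * (Real.pi / 5)) * sin (z - 2 * (Real.pi / 5)))) ≠ 0 := by
    rw [sin_five_prod z]; exact div_ne_zero hs (by norm_num)
  simp only [mul_ne_zero_iff] at hne
  obtain ⟨-, ⟨n1, n2⟩, n3, n4⟩ := hne
  have hi : ((Real.pi : ℂ) / 5).im = 0 := by
    rw [show (Real.pi : ℂ) / 5 = ((Real.pi / 5 : ℝ) : ℂ) by push_cast; rfl, ofReal_im]
  have hi2 : (2 * ((Real.pi : ℂ) / 5)).im = 0 := by simp [hi]
  have s1 := hasSum_theta1LogDeriv_sub_cot hτ (z := z + Real.pi / 5)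
    (by rwa [add_im, hi, add_zero]) n1
  have s2 := hasSum_theta1LogDeriv_sub_cot hτ (z := z - Real.pi / 5)
    (by rwa [sub_im, hi, sub_zero]) n2
  have s3 := hasSum_theta1LogDeriv_sub_cot hτ (z := z + 2 * (Real.pi / 5))
    (by rwa [add_im, hi2, add_zero]) n3
  have s4 := hasSum_theta1LogDeriv_sub_cot hτ (z := z - 2 * (Real.pi / 5))
    (by rwa [sub_im, hi2, sub_zero]) n4
  have h := (((s1.add s2).sub s3).sub s4).mul_left (4 * sqrtFive)⁻¹
  have h5 := sqrtFive_ne_zero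
  convert hasSum_of_eq h (fun n => ?_) using 1
  · have a1 := theta1LogDeriv_real_shift hτ hz hs
    have a2 := cot_four_term hs
    rw [eq_inv_mul_iff_mul_eq₀ (by simp [h5])]
    linear_combination a2 - a1
  · rw [eq_inv_mul_iff_mul_eq₀ (by simp [h5]), termA]
    have hx : ∀ v : ℂ, sin (2 * (n : ℕ) * (z + v)) + sin (2 * (n : ℕ) * (z - v)) =
        2 * sin (2 * (n : ℕ) * z) * cos (2 * (n : ℕ) * v) := by
      intro v
      rw [mul_add, mul_sub, sin_add, sin_sub]
      ring
    have h1 := hx (Real.pi / 5)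
    have h2 := hx (2 * (Real.pi / 5))
    have h3 := chi5_gauss n
    linear_combination 4 * (q τ ^ (n : ℕ) / (1 - q τ ^ (n : ℕ))) *
      (sin (2 * (n : ℕ) * z) * h3 - h1 + h2)

/-! ### The shift v = πτ and the second identity. -/

/-- Multisection of `(x; q)_∞` by residues modulo five. -/
lemma qPoch_residues {q : ℂ} (hq : ‖q‖ < 1) (x : ℂ) :
    qPoch (q ^ 5) x * qPoch (q ^ 5) (q * x) * qPoch (q ^ 5) (q ^ 2 * x) * qPoch (q ^ 5) (q ^ 3 * x) *
      qPoch (q ^ 5) (q ^ 4 * x) = qPoch q x := by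
  have hq5 := norm_pow_five_lt_one hq
  have h := ((((tendsto_qPoch hq5 x).mul (tendsto_qPoch hq5 (q * x))).mul
    (tendsto_qPoch hq5 (q ^ 2 * x))).mul (tendsto_qPoch hq5 (q ^ 3 * x))).mul
    (tendsto_qPoch hq5 (q ^ 4 * x))
  simp only [← Finset.prod_mul_distrib] at h
  have ht : Tendsto (fun n : ℕ => 5 * n) atTop atTop :=
    tendsto_atTop_mono (f := fun n : ℕ => n) (fun n => by omega) tendsto_id
  refine tendsto_nhds_unique (h.congr fun n => ?_) ((tendsto_qPoch hq x).comp ht)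
  simp only [Function.comp]
  induction n with
  | zero => simp
  | succ n ih =>
    rw [Finset.prod_range_succ, ih, show 5 * (n + 1) = 5 * n + 1 + 1 + 1 + 1 + 1 by ring]
    simp only [Finset.prod_range_succ]
    ring

/-- The sine is absorbed as the factor 1 - e^{2iz}, so that a shift by kπτ only multiplies the
arguments by powers of q. -/
lemma theta1_eq_prod' {τ : ℂ} (hτ : 0 < τ.im) (z : ℂ) :
    theta1 z τ = I * cexp (2 * Real.pi * I * τ / 8) * cexp (-(I * z)) *
      qPoch (q τ) (cexp (2 * I * z)) * qPoch (q τ) (q τ * cexp (-(2 * I * z))) *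
        qPoch (q τ) (q τ) := by
  have h := one_sub_exp_inv (-z)
  simp only [mul_neg, neg_neg, sin_neg] at h
  have h2 : cexp (-(I * z)) * cexp (I * z) = 1 := by rw [← exp_add]; simp
  rw [theta1_eq_prod hτ, qPoch_eq_mul (norm_q_lt_one hτ) (cexp (2 * I * z)), h]
  generalize qPoch (q τ) (q τ * cexp (2 * I * z)) = A
  generalize qPoch (q τ) (q τ * cexp (-(2 * I * z))) = B
  generalize qPoch (q τ) (q τ) = C
  generalize cexp (2 * Real.pi * I * τ / 8) = E
  linear_combination (2 * I ^ 2 * A * B * C * E * sin z) * h2 + (2 * A * B * C * E * sin z) * I_sq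

lemma theta1_shift {τ : ℂ} (hτ : 0 < τ.im) (z : ℂ) {k m : ℕ} (hkm : k + m = 5) :
    theta1 (z + k * (Real.pi * τ)) (5 * τ) = I * cexp (2 * Real.pi * I * (5 * τ) / 8) *
      (cexp (-(I * z)) * cexp (-(k * (Real.pi * I * τ)))) *
      qPoch (q τ ^ 5) (q τ ^ k * cexp (2 * I * z)) *
      qPoch (q τ ^ 5) (q τ ^ m * cexp (-(2 * I * z))) * qPoch (q τ ^ 5) (q τ ^ 5) := by
  rw [theta1_eq_prod' (five_mul_im_pos hτ), q_five_mul]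
  have e1 : cexp (2 * I * (z + k * (Real.pi * τ))) = q τ ^ k * cexp (2 * I * z) := by
    rw [q, ← exp_nat_mul, ← exp_add]; ring_nf
  have e2 : q τ ^ 5 * cexp (-(2 * I * (z + k * (Real.pi * τ)))) =
      q τ ^ m * cexp (-(2 * I * z)) := by
    rw [q, ← exp_nat_mul, ← exp_nat_mul, ← exp_add, ← exp_add]
    congr 1
    have : (m : ℂ) = 5 - k := by rw [eq_sub_iff_add_eq, add_comm]; exact_mod_cast hkm
    rw [this]
    push_cast
    ring
  have e3 : cexp (-(I * (z + k * (Real.pi * τ)))) =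
      cexp (-(I * z)) * cexp (-(k * (Real.pi * I * τ))) := by
    rw [← exp_add]; ring_nf
  rw [e1, e2, e3]

lemma theta1_shift_neg {τ : ℂ} (hτ : 0 < τ.im) (z : ℂ) {k m : ℕ} (hkm : k + m = 5) :
    theta1 (z - k * (Real.pi * τ)) (5 * τ) = -(I * cexp (2 * Real.pi * I * (5 * τ) / 8) *
      (cexp (I * z) * cexp (-(k * (Real.pi * I * τ)))) *
      qPoch (q τ ^ 5) (q τ ^ k * cexp (-(2 * I * z))) *
      qPoch (q τ ^ 5) (q τ ^ m * cexp (2 * I * z)) * qPoch (q τ ^ 5) (q τ ^ 5)) := by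
  have h := theta1_shift hτ (-z) hkm
  simp only [mul_neg, neg_neg] at h
  rw [show z - k * (Real.pi * τ) = -(-z + k * (Real.pi * τ)) by ring, theta1_neg, h]

lemma theta1_prod_imag_shift {τ : ℂ} (hτ : 0 < τ.im) (z : ℂ) :
    theta1 z (5 * τ) * (theta1 (z + Real.pi * τ) (5 * τ) * theta1 (z - Real.pi * τ) (5 * τ) *
      (theta1 (z + 2 * (Real.pi * τ)) (5 * τ) * theta1 (z - 2 * (Real.pi * τ)) (5 * τ))) *
      (q τ * ModularForm.eta τ) = theta1 z τ * ModularForm.eta (5 * τ) ^ 5 := by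
  have hq := norm_q_lt_one hτ
  have t0 := theta1_shift hτ z (k := 0) (m := 5) rfl
  have t1 := theta1_shift hτ z (k := 1) (m := 4) rfl
  have t2 := theta1_shift hτ z (k := 2) (m := 3) rfl
  have t3 := theta1_shift_neg hτ z (k := 1) (m := 4) rfl
  have t4 := theta1_shift_neg hτ z (k := 2) (m := 3) rfl
  simp only [Nat.cast_zero, Nat.cast_one, Nat.cast_ofNat, zero_mul, one_mul, add_zero, pow_zero,
    pow_one, neg_zero, exp_zero, mul_one] at t0 t1 t2 t3 t4
  -- The five shifts contribute q^j e^{2iz} for j = 0,…,4 and q^j e^{-2iz} for j = 1,…,5: each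
  -- residue class mod 5 once.
  have h1 := qPoch_residues hq (cexp (2 * I * z))
  have h2 := qPoch_residues hq (q τ * cexp (-(2 * I * z)))
  simp only [← mul_assoc, ← pow_succ, ← pow_two] at h2
  norm_num only at h2
  have hw : cexp (I * z) * cexp (-(I * z)) = 1 := by rw [← exp_add]; simp
  have hc : cexp (2 * Real.pi * I * (5 * τ) / 8) ^ 5 * cexp (-(Real.pi * I * τ)) ^ 2 *
      cexp (-(2 * (Real.pi * I * τ))) ^ 2 * q τ * cexp (2 * Real.pi * I * τ / 24) =
      cexp (2 * Real.pi * I * τ / 8) * cexp (2 * Real.pi * I * (5 * τ) / 24) ^ 5 := by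
    rw [q]
    simp only [← exp_nat_mul, ← exp_add]
    congr 1
    push_cast
    ring
  have hw2 : cexp (I * z) ^ 2 * cexp (-(I * z)) ^ 2 = 1 := by rw [← mul_pow, hw, one_pow]
  have hI : I ^ 5 = I := by rw [pow_succ, I_pow_four, one_mul]
  rw [t0, t1, t2, t3, t4, theta1_eq_prod' hτ, ← h1, ← h2, eta_eq, eta_eq, q_five_mul]
  generalize cexp (2 * Real.pi * I * (5 * τ) / 8) = F at *
  generalize cexp (2 * Real.pi * I * τ / 8) = E at *
  generalize cexp (2 * Real.pi * I * (5 * τ) / 24) = G at *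
  generalize cexp (2 * Real.pi * I * τ / 24) = H at *
  generalize cexp (-(Real.pi * I * τ)) = K at *
  generalize cexp (-(2 * (Real.pi * I * τ))) = L at *
  generalize cexp (I * z) = x at *
  generalize cexp (-(I * z)) = y at *
  generalize qPoch (q τ ^ 5) (cexp (2 * I * z)) = A0 at *
  generalize qPoch (q τ ^ 5) (q τ * cexp (2 * I * z)) = A1 at *
  generalize qPoch (q τ ^ 5) (q τ ^ 2 * cexp (2 * I * z)) = A2 at *
  generalize qPoch (q τ ^ 5) (q τ ^ 3 * cexp (2 * I * z)) = A3 at *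
  generalize qPoch (q τ ^ 5) (q τ ^ 4 * cexp (2 * I * z)) = A4 at *
  generalize qPoch (q τ ^ 5) (q τ * cexp (-(2 * I * z))) = B1 at *
  generalize qPoch (q τ ^ 5) (q τ ^ 2 * cexp (-(2 * I * z))) = B2 at *
  generalize qPoch (q τ ^ 5) (q τ ^ 3 * cexp (-(2 * I * z))) = B3 at *
  generalize qPoch (q τ ^ 5) (q τ ^ 4 * cexp (-(2 * I * z))) = B4 at *
  generalize qPoch (q τ ^ 5) (q τ ^ 5 * cexp (-(2 * I * z))) = B5 at *
  generalize qPoch (q τ ^ 5) (q τ ^ 5) = P5 at *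
  generalize qPoch (q τ) (q τ) = P at *
  linear_combination (A0 * A1 * A2 * A3 * A4 * (B1 * B2 * B3 * B4 * B5) * P5 ^ 5 * P * y) *
    (F ^ 5 * K ^ 2 * L ^ 2 * q τ * H * (x ^ 2 * y ^ 2 * hI + I * hw2) + I * hc)

lemma theta1_special_imag {τ : ℂ} (hτ : 0 < τ.im) :
    theta1 (3 * (Real.pi * τ)) (5 * τ) * theta1 (Real.pi * τ) (5 * τ) * q τ =
      -(ModularForm.eta τ * ModularForm.eta (5 * τ)) := by
  have hq := norm_q_lt_one hτ
  have t1 := theta1_shift hτ 0 (k := 1) (m := 4) rfl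
  have t3 := theta1_shift hτ 0 (k := 3) (m := 2) rfl
  simp only [Nat.cast_one, Nat.cast_ofNat, one_mul, zero_add, mul_zero,
    pow_one, neg_zero, exp_zero, mul_one] at t1 t3
  have h := qPoch_residues hq (q τ)
  simp only [← pow_succ, ← pow_two] at h
  norm_num only at h
  have hc : cexp (2 * Real.pi * I * (5 * τ) / 8) ^ 2 * cexp (-(3 * (Real.pi * I * τ))) *
      cexp (-(Real.pi * I * τ)) * q τ =
      cexp (2 * Real.pi * I * τ / 24) * cexp (2 * Real.pi * I * (5 * τ) / 24) := by
    rw [q]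
    simp only [← exp_nat_mul, ← exp_add]
    congr 1
    push_cast
    ring
  rw [t1, t3, eta_eq, eta_eq, q_five_mul, ← h]
  generalize cexp (2 * Real.pi * I * (5 * τ) / 8) = F at *
  generalize cexp (2 * Real.pi * I * (5 * τ) / 24) = G at *
  generalize cexp (2 * Real.pi * I * τ / 24) = H at *
  generalize cexp (-(Real.pi * I * τ)) = K at *
  generalize cexp (-(3 * (Real.pi * I * τ))) = L at *
  generalize qPoch (q τ ^ 5) (q τ) = A1 at *
  generalize qPoch (q τ ^ 5) (q τ ^ 2) = A2 at *
  generalize qPoch (q τ ^ 5) (q τ ^ 3) = A3 at *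
  generalize qPoch (q τ ^ 5) (q τ ^ 4) = A4 at *
  generalize qPoch (q τ ^ 5) (q τ ^ 5) = A5 at *
  linear_combination (A1 * A2 * A3 * A4 * A5 ^ 2) * (F ^ 2 * L * K * q τ * I_sq - hc)

lemma theta1LogDeriv_imag_shift {τ z : ℂ} (hτ : 0 < τ.im) (hz : |z.im| < Real.pi * τ.im)
    (hs : sin z ≠ 0) :
    theta1LogDeriv (5 * τ) (z + Real.pi * τ) + theta1LogDeriv (5 * τ) (z - Real.pi * τ) -
      theta1LogDeriv (5 * τ) (z + 2 * (Real.pi * τ)) -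
      theta1LogDeriv (5 * τ) (z - 2 * (Real.pi * τ)) = 4 * quotientB τ z := by
  have h5 := theta1_ne_zero hτ hz hs
  have he := eta_ne_zero' hτ
  have he5 := eta_ne_zero' (five_mul_im_pos hτ)
  have hq := q_ne_zero τ
  have hp := theta1_prod_imag_shift hτ z
  have hsp := theta1_special_imag hτ
  have hne := hp.symm ▸ mul_ne_zero h5 (pow_ne_zero 5 he5)
  simp only [mul_ne_zero_iff] at hne
  obtain ⟨⟨n0, ⟨n1, n2⟩, n3, n4⟩, -⟩ := hne
  rw [theta1LogDeriv_four_term (five_mul_im_pos hτ) n1 n2 n3 n4,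
    deriv_theta1_zero (five_mul_im_pos hτ), eq_div_of_mul_eq hq hsp, quotientB]
  generalize theta1 (z + Real.pi * τ) (5 * τ) = a at *
  generalize theta1 (z - Real.pi * τ) (5 * τ) = b at *
  generalize theta1 (z + 2 * (Real.pi * τ)) (5 * τ) = c at *
  generalize theta1 (z - 2 * (Real.pi * τ)) (5 * τ) = d at *
  generalize theta1 z τ = t at *
  generalize ModularForm.eta (5 * τ) = e5 at *
  generalize ModularForm.eta τ = e at *
  generalize theta1 z (5 * τ) = u at *
  generalize theta1 (2 * z) (5 * τ) = w at *
  field_simp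
  linear_combination (-4 * w) * hp

/-- Both z + kπτ and -z + kπτ lie in the upper strip for modulus 5τ, since 1 ≤ k ≤ 4. By oddness of
L the second gives z - kπτ; the constants i cancel and the exponentials pair into sines. -/
lemma hasSum_theta1LogDeriv_imag_pair {τ z : ℂ} (hτ : 0 < τ.im) (hz : |z.im| < Real.pi * τ.im)
    {k m : ℕ} (hkm : k + m = 5) (hk : 1 ≤ k) (hm : 1 ≤ m) :
    HasSum (fun n : ℕ+ => 4 * ((q τ ^ (k * (n : ℕ)) + q τ ^ (m * (n : ℕ))) /
      (1 - q τ ^ (5 * (n : ℕ))) * sin (2 * (n : ℕ) * z)))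
      (theta1LogDeriv (5 * τ) (z + k * (Real.pi * τ)) +
        theta1LogDeriv (5 * τ) (z - k * (Real.pi * τ))) := by
  obtain ⟨h1, h2⟩ := abs_lt.mp hz
  have hkr : (1 : ℝ) ≤ k := by exact_mod_cast hk
  have hk4 : (k : ℝ) ≤ 4 := by exact_mod_cast (show k ≤ 4 by omega)
  have hpos : 0 < Real.pi * τ.im := mul_pos Real.pi_pos hτ
  have him : ((k : ℂ) * (Real.pi * τ)).im = k * (Real.pi * τ.im) := by simp
  have him5 : (5 * τ).im = 5 * τ.im := by simp
  have s1 := hasSum_theta1LogDeriv_add_I (five_mul_im_pos hτ) (z := z + k * (Real.pi * τ))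
    (by rw [add_im, him]; nlinarith) (by rw [add_im, him, him5]; nlinarith)
  have s2 := hasSum_theta1LogDeriv_add_I (five_mul_im_pos hτ) (z := -z + k * (Real.pi * τ))
    (by rw [add_im, neg_im, him]; nlinarith) (by rw [add_im, neg_im, him, him5]; nlinarith)
  convert hasSum_of_eq (s1.sub s2) (fun n => ?_) using 1
  · rw [show z - k * (Real.pi * τ) = -(-z + k * (Real.pi * τ)) by ring, theta1LogDeriv_neg]
    ring
  · have e1 : cexp ((n : ℕ) * (2 * I * (z + k * (Real.pi * τ)))) =
        q τ ^ (k * (n : ℕ)) * cexp (2 * (n : ℕ) * z * I) := by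
      rw [q, ← exp_nat_mul, ← exp_add]; push_cast; ring_nf
    have e2 : cexp ((n : ℕ) * (2 * I * (-z + k * (Real.pi * τ)))) =
        q τ ^ (k * (n : ℕ)) * cexp (-(2 * (n : ℕ) * z) * I) := by
      rw [q, ← exp_nat_mul, ← exp_add]; push_cast; ring_nf
    have hm' : (m : ℂ) = 5 - k := by rw [eq_sub_iff_add_eq, add_comm]; exact_mod_cast hkm
    have e3 : (q τ ^ 5) ^ (n : ℕ) * cexp (-((n : ℕ) * (2 * I * (z + k * (Real.pi * τ))))) =
        q τ ^ (m * (n : ℕ)) * cexp (-(2 * (n : ℕ) * z) * I) := by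
      rw [← pow_mul, q, ← exp_nat_mul, ← exp_nat_mul, ← exp_add, ← exp_add]
      push_cast
      rw [hm']
      ring_nf
    have e4 : (q τ ^ 5) ^ (n : ℕ) * cexp (-((n : ℕ) * (2 * I * (-z + k * (Real.pi * τ))))) =
        q τ ^ (m * (n : ℕ)) * cexp (2 * (n : ℕ) * z * I) := by
      rw [← pow_mul, q, ← exp_nat_mul, ← exp_nat_mul, ← exp_add, ← exp_add]
      push_cast
      rw [hm']
      ring_nf
    rw [q_five_mul, e1, e2, e3, e4, sin, ← pow_mul]
    ring

lemma hasSum_termB {τ z : ℂ} (hτ : 0 < τ.im) (hz : |z.im| < Real.pi * τ.im)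
    (hs : sin z ≠ 0) : HasSum (termB τ z) (quotientB τ z) := by
  have s1 := hasSum_theta1LogDeriv_imag_pair hτ hz (k := 1) (m := 4) rfl le_rfl (by norm_num)
  have s2 := hasSum_theta1LogDeriv_imag_pair hτ hz (k := 2) (m := 3) rfl (by norm_num) (by norm_num)
  have h := theta1LogDeriv_imag_shift hτ hz hs
  simp only [Nat.cast_one, Nat.cast_ofNat, one_mul] at s1 s2
  convert hasSum_of_eq ((s1.sub s2).mul_left (1 / 4)) (fun n => ?_) using 1
  · linear_combination (-1 / 4) * h
  · rw [termB]
    ring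

/-! ### Limits as z → 0. -/

lemma norm_cos_le_exp (w : ℂ) : ‖cos w‖ ≤ Real.exp |w.im| := by
  have h1 : ‖cexp (w * I)‖ ≤ Real.exp |w.im| := by
    rw [norm_exp]
    simpa using neg_le_abs w.im
  have h2 : ‖cexp (-w * I)‖ ≤ Real.exp |w.im| := by
    rw [norm_exp]
    simpa using le_abs_self w.im
  rw [cos, norm_div, RCLike.norm_ofNat]
  have := norm_add_le (cexp (w * I)) (cexp (-w * I))
  linarith

/-- On the ball of radius c/2, cos(2nz) is at most e^{cn}, against coefficients of size e^{-2cn}.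
The differentiated series is thus dominated by a multiple of n e^{-cn}. -/
lemma hasDerivAt_tsum_sin {a : ℕ+ → ℂ} {C c : ℝ} (hc : 0 < c)
    (ha : ∀ n : ℕ+, ‖a n‖ ≤ C * Real.exp (-(2 * c)) ^ (n : ℕ)) :
    (Summable fun n : ℕ+ => a n * (2 * (n : ℕ))) ∧
    HasDerivAt (fun z : ℂ => ∑' n : ℕ+, a n * sin (2 * (n : ℕ) * z))
      (∑' n : ℕ+, a n * (2 * (n : ℕ))) 0 := by
  have hC : 0 ≤ C := by
    have := (norm_nonneg _).trans (ha 1)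
    exact nonneg_of_mul_nonneg_left this (by positivity)
  have hu : Summable fun n : ℕ+ => 2 * C * (((n : ℕ) : ℝ) ^ 1 * Real.exp (-c) ^ (n : ℕ)) := by
    refine Summable.mul_left _ ((summable_pnat_iff_summable_nat
      (f := fun n => (n : ℝ) ^ 1 * Real.exp (-c) ^ n)).mpr
      (summable_pow_mul_geometric_of_norm_lt_one 1 ?_))
    rw [Real.norm_eq_abs, abs_of_pos (Real.exp_pos _), Real.exp_lt_one_iff]
    linarith
  have hb : ∀ (n : ℕ+) (y : ℂ), y ∈ Metric.ball (0 : ℂ) (c / 2) →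
      ‖a n * (cos (2 * (n : ℕ) * y) * (2 * (n : ℕ)))‖ ≤
        2 * C * (((n : ℕ) : ℝ) ^ 1 * Real.exp (-c) ^ (n : ℕ)) := by
    intro n y hy
    have hy : |y.im| ≤ c / 2 := (abs_im_le_norm y).trans (mem_ball_zero_iff.mp hy).le
    have him : (2 * ((n : ℕ) : ℂ) * y).im = 2 * (n : ℕ) * y.im := by simp
    have h1 : ‖cos (2 * (n : ℕ) * y)‖ ≤ Real.exp c ^ (n : ℕ) := by
      refine (norm_cos_le_exp _).trans ?_
      rw [him, abs_mul, abs_of_nonneg (by positivity), ← Real.exp_nat_mul, Real.exp_le_exp]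
      nlinarith [(Nat.cast_nonneg (n : ℕ) : (0 : ℝ) ≤ (n : ℕ))]
    have h2 : Real.exp (-(2 * c)) * Real.exp c = Real.exp (-c) := by
      rw [← Real.exp_add]; ring_nf
    rw [norm_mul, norm_mul, norm_mul, RCLike.norm_ofNat, RCLike.norm_natCast, ← h2, mul_pow]
    calc ‖a n‖ * (‖cos (2 * (n : ℕ) * y)‖ * (2 * (n : ℕ)))
        ≤ (C * Real.exp (-(2 * c)) ^ (n : ℕ)) * (Real.exp c ^ (n : ℕ) * (2 * (n : ℕ))) :=
          mul_le_mul (ha n) (mul_le_mul_of_nonneg_right h1 (by positivity)) (by positivity)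
            (by positivity)
      _ = _ := by ring
  have h0 : (0 : ℂ) ∈ Metric.ball (0 : ℂ) (c / 2) := by simp [hc]
  refine ⟨Summable.of_norm_bounded hu fun n => ?_, ?_⟩
  · simpa using hb n 0 h0
  · have h := hasDerivAt_tsum_of_isPreconnected (y₀ := 0) (y := 0)
      (g := fun (n : ℕ+) z => a n * sin (2 * (n : ℕ) * z)) hu Metric.isOpen_ball
      (convex_ball (0 : ℂ) (c / 2)).isPreconnected (fun n y _ => ?_) hb h0
      (by simp) h0
    · simpa using h
    · have h1 := ((hasDerivAt_id y).const_mul (2 * ((n : ℕ) : ℂ))).csin.const_mul (a n)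
      simpa using h1

lemma tendsto_div_of_hasDerivAt {f : ℂ → ℂ} {f' : ℂ} (h : HasDerivAt f f' 0) (h0 : f 0 = 0) :
    Tendsto (fun z => f z / z) (𝓝[≠] 0) (𝓝 f') := by
  have := hasDerivAt_iff_tendsto_slope_zero.mp h
  simpa [h0, div_eq_inv_mul] using this

lemma tendsto_sin_mul_div (c : ℂ) : Tendsto (fun z : ℂ => sin (c * z) / z) (𝓝[≠] 0) (𝓝 c) := by
  refine tendsto_div_of_hasDerivAt ?_ (by simp)
  simpa using ((hasDerivAt_id (0 : ℂ)).const_mul c).csin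

lemma tendsto_theta1_mul_div {τ : ℂ} (hτ : 0 < τ.im) (c : ℂ) :
    Tendsto (fun z : ℂ => theta1 (c * z) τ / z) (𝓝[≠] 0) (𝓝 (c * (2 * ModularForm.eta τ ^ 3))) := by
  refine tendsto_div_of_hasDerivAt ?_ (by simp [theta1_zero])
  have h := ((differentiable_theta1 hτ) (c * 0)).hasDerivAt.comp (0 : ℂ)
    ((hasDerivAt_id (0 : ℂ)).const_mul c)
  rw [mul_zero, deriv_theta1_zero hτ] at h
  exact h.congr_deriv (by ring)

lemma tendsto_quotientA {τ : ℂ} (hτ : 0 < τ.im) :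
    Tendsto (fun z : ℂ => quotientA τ z / z) (𝓝[≠] 0)
      (𝓝 (2 / 5 * (ModularForm.eta τ ^ 5 / ModularForm.eta (5 * τ)))) := by
  have he := eta_ne_zero' hτ
  have he5 := eta_ne_zero' (five_mul_im_pos hτ)
  have h := (((tendsto_theta1_mul_div hτ 1).mul (tendsto_theta1_mul_div hτ 2)).const_mul
    (ModularForm.eta (5 * τ) ^ 2)).div
    ((tendsto_theta1_mul_div (five_mul_im_pos hτ) 5).const_mul (2 * ModularForm.eta τ))
    (by simp [he, he5])
  rw [show ModularForm.eta (5 * τ) ^ 2 * (1 * (2 * ModularForm.eta τ ^ 3) *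
    (2 * (2 * ModularForm.eta τ ^ 3))) / (2 * ModularForm.eta τ *
      (5 * (2 * ModularForm.eta (5 * τ) ^ 3))) =
      2 / 5 * (ModularForm.eta τ ^ 5 / ModularForm.eta (5 * τ)) by field_simp] at h
  refine h.congr' ?_
  filter_upwards [self_mem_nhdsWithin] with z hz
  have hz : z ≠ 0 := hz
  simp only [Pi.div_apply, quotientA, one_mul]
  generalize theta1 (5 * z) (5 * τ) = t
  -- Where the denominator vanishes both sides are 0 by the convention for division, so the equality
  -- needs only z ≠ 0.
  by_cases ht : t = 0
  · simp [ht]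
  · field_simp

lemma tendsto_quotientB {τ : ℂ} (hτ : 0 < τ.im) :
    Tendsto (fun z : ℂ => quotientB τ z / z) (𝓝[≠] 0)
      (𝓝 (2 * (ModularForm.eta (5 * τ) ^ 5 / ModularForm.eta τ))) := by
  have he := eta_ne_zero' hτ
  have he5 := eta_ne_zero' (five_mul_im_pos hτ)
  have h := (((tendsto_theta1_mul_div (five_mul_im_pos hτ) 1).mul
    (tendsto_theta1_mul_div (five_mul_im_pos hτ) 2)).const_mul (ModularForm.eta τ ^ 2)).div
    ((tendsto_theta1_mul_div hτ 1).const_mul (2 * ModularForm.eta (5 * τ)))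
    (by simp [he, he5])
  rw [show ModularForm.eta τ ^ 2 * (1 * (2 * ModularForm.eta (5 * τ) ^ 3) *
    (2 * (2 * ModularForm.eta (5 * τ) ^ 3))) / (2 * ModularForm.eta (5 * τ) *
      (1 * (2 * ModularForm.eta τ ^ 3))) =
      2 * (ModularForm.eta (5 * τ) ^ 5 / ModularForm.eta τ) by field_simp] at h
  refine h.congr' ?_
  filter_upwards [self_mem_nhdsWithin] with z hz
  have hz : z ≠ 0 := hz
  simp only [Pi.div_apply, quotientB, one_mul]
  generalize theta1 z τ = t
  by_cases ht : t = 0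
  · simp [ht]
  · field_simp

/-! ### Coefficient bounds and Ramanujan's series. -/

lemma legendreSym_five_add (n : ℕ) :
    legendreSym 5 ((n + 5 : ℕ) : ℤ) = legendreSym 5 (n : ℤ) := by
  rw [legendreSym.mod, legendreSym.mod 5 (n : ℤ)]
  congr 1
  push_cast
  omega

lemma norm_legendreSym_five_le (n : ℤ) : ‖((legendreSym 5 n : ℤ) : ℂ)‖ ≤ 1 := by
  by_cases h : ((n : ℤ) : ZMod 5) = 0
  · rw [(legendreSym.eq_zero_iff 5 n).mpr h]
    simp
  · rcases legendreSym.eq_one_or_neg_one 5 h with h | h <;> simp [h]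

lemma norm_chi5_le (n : ℕ+) : ‖chi5 n‖ ≤ 1 := norm_legendreSym_five_le _

lemma norm_inv_one_sub_pow_le {q : ℂ} (hq : ‖q‖ < 1) {n : ℕ} (hn : n ≠ 0) :
    ‖(1 - q ^ n)⁻¹‖ ≤ (1 - ‖q‖)⁻¹ := by
  have h1 : ‖q ^ n‖ ≤ ‖q‖ := by
    rw [norm_pow]
    exact pow_le_of_le_one (norm_nonneg _) hq.le hn
  have h2 := norm_sub_norm_le (1 : ℂ) (q ^ n)
  rw [norm_one] at h2
  rw [norm_inv]
  exact inv_anti₀ (by linarith) (by linarith)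

lemma norm_coeffA_le {τ : ℂ} (hτ : 0 < τ.im) (n : ℕ+) :
    ‖chi5 n * (q τ ^ (n : ℕ) / (1 - q τ ^ (n : ℕ)))‖ ≤
      (1 - ‖q τ‖)⁻¹ * Real.exp (-(2 * (Real.pi * τ.im))) ^ (n : ℕ) := by
  have hq := norm_q_lt_one hτ
  have h1 := norm_inv_one_sub_pow_le hq n.ne_zero
  rw [← mul_assoc 2, ← norm_q, norm_mul, div_eq_mul_inv, norm_mul, norm_pow]
  calc ‖chi5 n‖ * (‖q τ‖ ^ (n : ℕ) * ‖(1 - q τ ^ (n : ℕ))⁻¹‖)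
      ≤ 1 * (‖q τ‖ ^ (n : ℕ) * (1 - ‖q τ‖)⁻¹) :=
        mul_le_mul (norm_chi5_le n) (mul_le_mul_of_nonneg_left h1 (by positivity)) (by positivity)
          zero_le_one
    _ = _ := by ring

/-- The coefficient of `sin (2nz)` in the second Lambert series. -/
noncomputable def coeffB (τ : ℂ) (n : ℕ+) : ℂ :=
  (q τ ^ (n : ℕ) - q τ ^ (2 * (n : ℕ)) - q τ ^ (3 * (n : ℕ)) + q τ ^ (4 * (n : ℕ)))
    / (1 - q τ ^ (5 * (n : ℕ)))

lemma norm_coeffB_le {τ : ℂ} (hτ : 0 < τ.im) (n : ℕ+) :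
    ‖coeffB τ n‖ ≤ 4 * (1 - ‖q τ‖)⁻¹ * Real.exp (-(2 * (Real.pi * τ.im))) ^ (n : ℕ) := by
  have hq := norm_q_lt_one hτ
  have h1 := norm_inv_one_sub_pow_le hq (n := 5 * (n : ℕ)) (by simp)
  have h2 : ∀ k : ℕ, 1 ≤ k → ‖q τ ^ (k * (n : ℕ))‖ ≤ ‖q τ‖ ^ (n : ℕ) := by
    intro k hk
    rw [norm_pow]
    exact pow_le_pow_of_le_one (norm_nonneg _) hq.le (Nat.le_mul_of_pos_left _ hk)
  have g1 := h2 1 le_rfl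
  have g2 := h2 2 (by norm_num)
  have g3 := h2 3 (by norm_num)
  have g4 := h2 4 (by norm_num)
  rw [one_mul] at g1
  have h3 : ‖q τ ^ (n : ℕ) - q τ ^ (2 * (n : ℕ)) - q τ ^ (3 * (n : ℕ)) + q τ ^ (4 * (n : ℕ))‖ ≤
      4 * ‖q τ‖ ^ (n : ℕ) := by
    have a1 := norm_add_le (q τ ^ (n : ℕ) - q τ ^ (2 * (n : ℕ)) - q τ ^ (3 * (n : ℕ)))
      (q τ ^ (4 * (n : ℕ)))
    have a2 := norm_sub_le (q τ ^ (n : ℕ) - q τ ^ (2 * (n : ℕ))) (q τ ^ (3 * (n : ℕ)))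
    have a3 := norm_sub_le (q τ ^ (n : ℕ)) (q τ ^ (2 * (n : ℕ)))
    linarith
  rw [← mul_assoc 2, ← norm_q, coeffB, div_eq_mul_inv, norm_mul]
  calc _ ≤ 4 * ‖q τ‖ ^ (n : ℕ) * (1 - ‖q τ‖)⁻¹ :=
        mul_le_mul h3 h1 (norm_nonneg _) (by positivity)
    _ = _ := by ring

lemma tendsto_lambertA_div {τ : ℂ} (hτ : 0 < τ.im) :
    Summable (ramanujanTermA τ) ∧
    Tendsto (fun z : ℂ => lambertA τ z / z) (𝓝[≠] 0)
      (𝓝 (2 / 5 * (1 - 5 * ∑' n : ℕ+, ramanujanTermA τ n))) := by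
  obtain ⟨h1, h2⟩ := hasDerivAt_tsum_sin (mul_pos Real.pi_pos hτ) (norm_coeffA_le hτ)
  have e : ∀ n : ℕ+, chi5 n * (q τ ^ (n : ℕ) / (1 - q τ ^ (n : ℕ))) * (2 * ((n : ℕ) : ℂ)) =
      2 * ramanujanTermA τ n := by
    intro n
    rw [ramanujanTermA]
    ring
  simp only [e] at h1 h2
  rw [summable_mul_left_iff two_ne_zero] at h1
  refine ⟨h1, ?_⟩
  rw [tsum_mul_left] at h2
  have h3 := tendsto_div_of_hasDerivAt h2 (by simp)
  have h4 := (((tendsto_sin_mul_div 1).mul (tendsto_sin_mul_div 2)).div (tendsto_sin_mul_div 5)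
    (by norm_num)).sub h3
  rw [show (1 * 2 / 5 - 2 * ∑' n : ℕ+, ramanujanTermA τ n : ℂ) =
    2 / 5 * (1 - 5 * ∑' n : ℕ+, ramanujanTermA τ n) by ring] at h4
  refine h4.congr' ?_
  filter_upwards [self_mem_nhdsWithin] with z hz
  have hz : z ≠ 0 := hz
  simp only [Pi.div_apply, lambertA, one_mul, termA]
  rw [sub_div]
  congr 1
  by_cases ht : sin (5 * z) = 0
  · simp [ht]
  · field_simp

lemma tendsto_lambertB_div {τ : ℂ} (hτ : 0 < τ.im) :
    Tendsto (fun z : ℂ => lambertB τ z / z) (𝓝[≠] 0)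
      (𝓝 (2 * ∑' n : ℕ+, coeffB τ n * (n : ℕ))) := by
  obtain ⟨-, h2⟩ := hasDerivAt_tsum_sin (mul_pos Real.pi_pos hτ) (norm_coeffB_le hτ)
  have e : ∀ n : ℕ+, coeffB τ n * (2 * ((n : ℕ) : ℂ)) = 2 * (coeffB τ n * (n : ℕ)) := by
    intro n
    ring
  simp only [e, tsum_mul_left] at h2
  exact tendsto_div_of_hasDerivAt (f := lambertB τ) h2 (by simp [lambertB, termB])

/-- Periodicity gives S = (first five terms) + y⁵ S. -/
lemma hasSum_chi5_mul_pow {y : ℂ} (hy : ‖y‖ < 1) :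
    HasSum (fun m : ℕ+ => chi5 m * y ^ (m : ℕ)) ((y - y ^ 2 - y ^ 3 + y ^ 4) / (1 - y ^ 5)) := by
  have l0 : legendreSym 5 ((0 : ℕ) : ℤ) = 0 := by decide
  have l1 : legendreSym 5 ((1 : ℕ) : ℤ) = 1 := by decide
  have l2 : legendreSym 5 ((2 : ℕ) : ℤ) = -1 := by decide
  have l3 : legendreSym 5 ((3 : ℕ) : ℤ) = -1 := by decide
  have l4 : legendreSym 5 ((4 : ℕ) : ℤ) = 1 := by decide
  set f : ℕ → ℂ := fun m => (legendreSym 5 (m : ℤ) : ℂ) * y ^ m with hf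
  have hs : Summable f := by
    refine Summable.of_norm_bounded (summable_geometric_of_lt_one (norm_nonneg y) hy) fun m => ?_
    rw [hf, norm_mul, norm_pow]
    exact mul_le_of_le_one_left (by positivity) (norm_legendreSym_five_le _)
  have hshift : ∀ m, f (m + 5) = y ^ 5 * f m := by
    intro m
    simp only [hf, legendreSym_five_add]
    ring
  have h1 := hs.sum_add_tsum_nat_add 5
  simp only [hshift, tsum_mul_left] at h1
  simp only [Finset.sum_range_succ, Finset.sum_range_zero, hf, l0, l1, l2, l3, l4] at h1
  have hne := one_sub_pow_ne_zero hy (n := 5) (by norm_num)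
  have h2 : ∑' m, f m = (y - y ^ 2 - y ^ 3 + y ^ 4) / (1 - y ^ 5) := by
    rw [eq_div_iff hne]
    push_cast at h1
    linear_combination -h1
  have h3 := hs.hasSum
  rw [h2] at h3
  exact (hasSum_pnat_iff (f := f)).mpr (by simpa [hf] using h3)

lemma hasSum_pnat_mul_geometric {y : ℂ} (hy : ‖y‖ < 1) :
    HasSum (fun n : ℕ+ => ((n : ℕ) : ℂ) * y ^ (n : ℕ)) (y / (1 - y) ^ 2) := by
  have h := hasSum_coe_mul_geometric_of_norm_lt_one hy
  exact (hasSum_pnat_iff (f := fun n : ℕ => (n : ℂ) * y ^ n)).mpr (by simpa using h)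

/-- Sum (m/5) n q^(mn) both ways: over n first gives Ramanujan's series, over m first gives the
series found by differentiating the second Lambert series at 0. -/
lemma hasSum_ramanujanTermB {τ : ℂ} (hτ : 0 < τ.im) :
    HasSum (ramanujanTermB τ) (∑' n : ℕ+, coeffB τ n * (n : ℕ)) := by
  have hq := norm_q_lt_one hτ
  have hpow : ∀ n : ℕ+, ‖q τ ^ (n : ℕ)‖ < 1 := by
    intro n
    rw [norm_pow]
    exact pow_lt_one₀ (norm_nonneg _) hq n.ne_zero
  have hF : Summable fun c : ℕ+ × ℕ+ =>
      chi5 c.1 * (((c.2 : ℕ) : ℂ) * q τ ^ ((c.1 : ℕ) * (c.2 : ℕ))) := by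
    refine Summable.of_norm_bounded (summable_prod_mul_pow 1 hq).norm fun c => ?_
    rw [norm_mul, pow_one]
    exact mul_le_of_le_one_left (norm_nonneg _) (norm_chi5_le _)
  have hrow : ∀ m : ℕ+, HasSum
      (fun n : ℕ+ => chi5 m * (((n : ℕ) : ℂ) * q τ ^ ((m : ℕ) * (n : ℕ)))) (ramanujanTermB τ m) := by
    intro m
    simp only [pow_mul]
    exact (hasSum_pnat_mul_geometric (hpow m)).mul_left _
  have hcol : ∀ n : ℕ+, HasSum
      (fun m : ℕ+ => chi5 m * (((n : ℕ) : ℂ) * q τ ^ ((m : ℕ) * (n : ℕ)))) (coeffB τ n * (n : ℕ)) := by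
    intro n
    refine hasSum_of_eq (f := fun m : ℕ+ => chi5 m * (((n : ℕ) : ℂ) * q τ ^ ((m : ℕ) * (n : ℕ))))
      (g := fun m : ℕ+ => chi5 m * (q τ ^ (n : ℕ)) ^ (m : ℕ) * (n : ℕ)) ?_ fun m => ?_
    · have h := (hasSum_chi5_mul_pow (hpow n)).mul_right ((n : ℕ) : ℂ)
      simpa only [coeffB, ← pow_mul, mul_comm (n : ℕ)] using h
    · rw [← pow_mul, mul_comm (n : ℕ)]
      ring
  have h1 := hF.hasSum.prod_fiberwise hrow
  have h2 := (hF.prod_symm.hasSum).prod_fiberwise hcol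
  have h3 : ∑' b : ℕ+ × ℕ+, chi5 b.swap.1 *
      (((b.swap.2 : ℕ) : ℂ) * q τ ^ ((b.swap.1 : ℕ) * (b.swap.2 : ℕ))) =
      ∑' c : ℕ+ × ℕ+, chi5 c.1 * (((c.2 : ℕ) : ℂ) * q τ ^ ((c.1 : ℕ) * (c.2 : ℕ))) :=
    (Equiv.prodComm ℕ+ ℕ+).tsum_eq (fun c : ℕ+ × ℕ+ =>
      chi5 c.1 * (((c.2 : ℕ) : ℂ) * q τ ^ ((c.1 : ℕ) * (c.2 : ℕ))))
  rwa [← h3, ← h2.tsum_eq] at h1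

lemma eventually_strip {τ : ℂ} (hτ : 0 < τ.im) {c : ℂ} (hc : c ≠ 0) :
    ∀ᶠ z : ℂ in 𝓝[≠] 0, |z.im| < Real.pi * τ.im ∧ sin (c * z) ≠ 0 := by
  have h1 : ∀ᶠ z : ℂ in 𝓝[≠] 0, |z.im| < Real.pi * τ.im := by
    have hcont : Tendsto (fun z : ℂ => |z.im|) (𝓝 0) (𝓝 |(0 : ℂ).im|) :=
      (continuous_abs.comp continuous_im).tendsto 0
    refine (hcont.eventually_lt_const ?_).filter_mono nhdsWithin_le_nhds
    simpa using mul_pos Real.pi_pos hτ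
  filter_upwards [h1, (tendsto_sin_mul_div c).eventually_ne hc] with z hz1 hz2
  exact ⟨hz1, fun h => hz2 (by simp [h])⟩

end ThetaLambert

/-! ### Assembly. -/

theorem mainTheorem11 (τ : ℂ) (hτ : 0 < τ.im) :
    -- first Lambert series identity
    (∀ z : ℂ, |z.im| < Real.pi * τ.im → sin (5 * z) ≠ 0 →
      Summable (ThetaLambert.termA τ z) ∧
      ThetaLambert.theta1 (5 * z) (5 * τ) ≠ 0 ∧
      ThetaLambert.lambertA τ z = ThetaLambert.quotientA τ z) ∧
    -- second Lambert series identity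
    (∀ z : ℂ, |z.im| < Real.pi * τ.im → sin z ≠ 0 →
      Summable (ThetaLambert.termB τ z) ∧
      ThetaLambert.theta1 z τ ≠ 0 ∧
      ThetaLambert.lambertB τ z = ThetaLambert.quotientB τ z) ∧
    -- dividing the first identity by `z` and letting `z → 0` gives Ramanujan's first identity
    (Summable (ThetaLambert.ramanujanTermA τ) ∧
      Tendsto (fun z : ℂ => ThetaLambert.lambertA τ z / z) (𝓝[≠] 0)
        (𝓝 (2 / 5 * (1 - 5 * ∑' n : ℕ+, ThetaLambert.ramanujanTermA τ n))) ∧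
      Tendsto (fun z : ℂ => ThetaLambert.quotientA τ z / z) (𝓝[≠] 0)
        (𝓝 (2 / 5 * (ModularForm.eta τ ^ 5 / ModularForm.eta (5 * τ)))) ∧
      1 - 5 * ∑' n : ℕ+, ThetaLambert.ramanujanTermA τ n
        = ModularForm.eta τ ^ 5 / ModularForm.eta (5 * τ)) ∧
    -- dividing the second identity by `z` and letting `z → 0` gives Ramanujan's second identity
    (Summable (ThetaLambert.ramanujanTermB τ) ∧
      Tendsto (fun z : ℂ => ThetaLambert.lambertB τ z / z) (𝓝[≠] 0)
        (𝓝 (2 * ∑' n : ℕ+, ThetaLambert.ramanujanTermB τ n)) ∧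
      Tendsto (fun z : ℂ => ThetaLambert.quotientB τ z / z) (𝓝[≠] 0)
        (𝓝 (2 * (ModularForm.eta (5 * τ) ^ 5 / ModularForm.eta τ))) ∧
      ∑' n : ℕ+, ThetaLambert.ramanujanTermB τ n
        = ModularForm.eta (5 * τ) ^ 5 / ModularForm.eta τ) := by
  have hA : ∀ z : ℂ, |z.im| < Real.pi * τ.im → sin (5 * z) ≠ 0 →
      ThetaLambert.lambertA τ z = ThetaLambert.quotientA τ z := fun z hz hs => by
    rw [ThetaLambert.lambertA, (ThetaLambert.hasSum_termA hτ hz hs).tsum_eq, sub_sub_cancel]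
  have hB : ∀ z : ℂ, |z.im| < Real.pi * τ.im → sin z ≠ 0 →
      ThetaLambert.lambertB τ z = ThetaLambert.quotientB τ z := fun z hz hs =>
    (ThetaLambert.hasSum_termB hτ hz hs).tsum_eq
  obtain ⟨hsA, hlA⟩ := ThetaLambert.tendsto_lambertA_div hτ
  have hqA := ThetaLambert.tendsto_quotientA hτ
  have hlB := ThetaLambert.tendsto_lambertB_div hτ
  have hqB := ThetaLambert.tendsto_quotientB hτ
  have hsB := ThetaLambert.hasSum_ramanujanTermB hτ
  rw [← hsB.tsum_eq] at hlB
  have hevA : (fun z : ℂ => ThetaLambert.lambertA τ z / z) =ᶠ[𝓝[≠] 0]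
      fun z => ThetaLambert.quotientA τ z / z := by
    filter_upwards [ThetaLambert.eventually_strip hτ (c := 5) (by norm_num)] with z hz
    rw [hA z hz.1 hz.2]
  have hevB : (fun z : ℂ => ThetaLambert.lambertB τ z / z) =ᶠ[𝓝[≠] 0]
      fun z => ThetaLambert.quotientB τ z / z := by
    filter_upwards [ThetaLambert.eventually_strip hτ (c := 1) one_ne_zero] with z hz
    rw [hB z hz.1 (by simpa using hz.2)]
  refine ⟨fun z hz hs => ⟨(ThetaLambert.hasSum_termA hτ hz hs).summable,
      ThetaLambert.theta1_five_ne_zero hτ hz hs, hA z hz hs⟩,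
    fun z hz hs => ⟨(ThetaLambert.hasSum_termB hτ hz hs).summable,
      ThetaLambert.theta1_ne_zero hτ hz hs, hB z hz hs⟩,
    ⟨hsA, hlA, hqA, ?_⟩, ⟨hsB.summable, hlB, hqB, ?_⟩⟩
  -- The two sides agree in a punctured neighbourhood of 0, so their limits coincide; the factor 2/5
  -- is cancelled.
  · exact mul_left_cancel₀ (by norm_num) (tendsto_nhds_unique hlA (hqA.congr' hevA.symm))
  · exact mul_left_cancel₀ two_ne_zero (tendsto_nhds_unique hlB (hqB.congr' hevB.symm))
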